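/- **Theorem (Boolean completeness for $\mathrm{L}_{\infty\omega}$).** Let $\mathrm{L}$ be a first-order relational signature (a set of relation symbols of finite arity and a set of constant symbols), and let $T,S$ be sets of $\mathrm{L}_{\infty\omega}$-formulae. The following are equivalent: 1. $T\models_{\mathrm{Sh}}S$; 2. $T\models_{\mathrm{BVM}}S$; 3. $T\vdash S$, that is, the sequent $T\vdash S$ has a proof in the sequent calculus below consisting of sequents of $\mathrm{L}_{\infty\infty}$-formulae; 4. the sequent $T\vdash S$ has a proof in the same calculus consisting of sequents of $\mathrm{L}_{\infty\omega}$-formulae only. *Formulae.* There is a variable $v_\alpha$ for every ordinal $\alpha$; terms are variables and constant symbols; atomic formulae are $s=t$ and $R(t_1,\dots,t_n)$. The $\mathrm{L}_{\infty\infty}$-formulae are built from these by $\neg$, by $\bigwedge$ and $\bigvee$ of set-indexed families, and by $\forall V$, $\exists V$ for arbitrary sets $V$ of variables. An $\mathrm{L}_{\infty\omega}$-formula is one in which every quantified set $V$ is finite and in which the members of each conjunction and of each disjunction have, all together, only finitely many free variables. *Semantics.* For a complete Boolean algebra $\mathsf B$, a $\mathsf B$-valued model $\mathcal M$ consists of a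 non-empty set $M$, maps $[\![\cdot=\cdot]\!]:M^2\to\mathsf B$ and $[\![R(\cdot)]\!]:M^n\to\mathsf B$ for each $n$-ary $R$, and elements $c^{\mathcal M}\in M$ for the constants $c$, such that $[\![a=a]\!]=1$, $[\![a=b]\!]=[\![b=a]\!]$, $[\![a=b]\!]\wedge[\![b=c]\!]\le[\![a=c]\!]$ and $\bigwedge_i[\![a_i=b_i]\!]\wedge[\![R(\bar a)]\!]\le[\![R(\bar b)]\!]$. The value $[\![\varphi]\!]\in\mathsf B$ of a formula under an assignment of elements of $M$ to the variables is computed by interpreting $\neg,\bigwedge,\bigvee$ by the operations of $\mathsf B$, and $\forall V$, $\exists V$ by the infimum and the supremum over all elements of $M^V$. The model has the *mixing property* if for every antichain $A\subseteq\mathsf B$ and every family $(\tau_a)_{a\in A}$ in $M$ there is $\tau\in M$ with $a\le[\![\tau=\tau_a]\!]$ for all $a\in A$. One writes $T\models_{\mathrm{BVM}}S$ if $\bigwedge_{\varphi\in T}[\![\varphi]\!]\le\bigvee_{\psi\in S}[\![\psi]\!]$ for every complete Boolean algebra $\mathsf B$, every $\mathsf B$-valued model and every assignment (with $\bigwedge\emptyset=1$,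 $\bigvee\emptyset=0$), and $T\models_{\mathrm{Sh}}S$ if this holds for all models with the mixing property. *Calculus.* Sequents $\Gamma\vdash\Delta$ are pairs of sets of formulae in the logical symbols $\neg,\bigwedge,\forall$; a formula with $\bigvee$ or $\exists$ is first rewritten using $\neg\bigwedge_i\neg\varphi_i$ for $\bigvee_i\varphi_i$ and $\neg\forall V\neg\varphi$ for $\exists V\varphi$. Commas denote unions. $\varphi(\bar t/\bar v)$ is simultaneous substitution for the free occurrences of the distinct variables $\bar v$, and it is used only where no variable of a substituted term gets captured by a quantifier. The rules are: - Axiom: $\Gamma,\varphi\vdash\varphi,\Delta$. - Cut: from $\Gamma,\varphi\vdash\Delta$ and $\Gamma'\vdash\varphi,\Delta'$ infer $\Gamma,\Gamma'\vdash\Delta,\Delta'$. - Substitution: from $\Gamma\vdash\Delta$ infer $\Gamma(\bar w/\bar v)\vdash\Delta(\bar w/\bar v)$, where $\bar w$ is a sequence of variables. - Weakening: from $\Gamma\vdash\Delta$ infer $\Gamma,\Gamma'\vdash\Delta,\Delta'$. - Negation: from $\Gamma\vdash\varphi,\Delta$ infer $\Gamma,\neg\varphi\vdash\Delta$; from $\Gamma,\varphi\vdash\Delta$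 infer $\Gamma\vdash\neg\varphi,\Delta$. - Conjunction: from $\Gamma,\{\varphi_i:i\in I\}\vdash\Delta$ infer $\Gamma,\bigwedge_{i\in I}\varphi_i\vdash\Delta$; from $\Gamma\vdash\varphi_i,\Delta$ for all $i\in I$ infer $\Gamma\vdash\bigwedge_{i\in I}\varphi_i,\Delta$. - Quantification: from $\Gamma,\varphi(\bar t/\bar v)\vdash\Delta$ infer $\Gamma,\forall\bar v\,\varphi\vdash\Delta$; from $\Gamma\vdash\varphi(\bar w/\bar v),\Delta$ infer $\Gamma\vdash\forall\bar v\,\varphi,\Delta$, provided that $\bar w$ consists of distinct variables, none of which is free in a formula of $\Gamma\cup\Delta\cup\{\varphi\}$. - Equality: $\vdash t=t$; $\;v_\alpha=v_\beta\vdash v_\beta=v_\alpha$; $\;\bar u=\bar t,\ \varphi(\bar t)\vdash\varphi(\bar u)$. The sequents provable by means of formulae of a given class form the least class of sequents of such formulae that is closed under these rules; equivalently, they are the last members of well-ordered sequences of such sequents each of which is inferred by a rule from earlier ones. -/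

import Mathlib

universe u

namespace BoolInf

/-! ### Syntax -/

/-- A relational `ω`-signature: relation symbols of finite arity and constant symbols. -/
structure Signature : Type (u + 1) where
  /-- relation symbols -/
  Rel : Type u
  /-- arities of the relation symbols -/
  arity : Rel → ℕ
  /-- constant symbols -/
  Const : Type u

/-- The variables `v_α`, one for every ordinal `α`. The ordinals of a universe are a proper class
relative to that universe, so no set of variables exhausts them. -/
abbrev Var : Type (u + 1) := Ordinal.{u}

/-- Terms are variables and constant symbols. -/
inductive Term (L : Signature.{u}) : Type (u + 1)
  | var (x : Var.{u}) : Term L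
  | const (c : L.Const) : Term L

/-- Raw infinitary formulae over `L`: conjunctions and disjunctions of families indexed by a set
(a type in `Type u`), and simultaneous quantification over a collection `V` of variables. The size
restrictions of the logics `L_{∞∞}` and `L_{∞ω}` are imposed by `LInfInf` and `LInfOmega`. -/
inductive Formula (L : Signature.{u}) : Type (u + 1)
  | eq (s t : Term L) : Formula L
  | rel (R : L.Rel) (t : Fin (L.arity R) → Term L) : Formula L
  | neg (φ : Formula L) : Formula L
  | conj (ι : Type u) (φ : ι → Formula L) : Formula L
  | disj (ι : Type u) (φ : ι → Formula L) : Formula L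
  | all (V : Set Var.{u}) (φ : Formula L) : Formula L
  | ex (V : Set Var.{u}) (φ : Formula L) : Formula L

variable {L : Signature.{u}}

/-- The variables occurring in a term. -/
def Term.fv : Term L → Set Var.{u}
  | .var x => {x}
  | .const _ => ∅

/-- The free variables of a formula. -/
def Formula.fv : Formula L → Set Var.{u}
  | .eq s t => s.fv ∪ t.fv
  | .rel _ t => ⋃ i, (t i).fv
  | .neg φ => φ.fv
  | .conj _ φ => ⋃ i, (φ i).fv
  | .disj _ φ => ⋃ i, (φ i).fv
  | .all V φ => φ.fv \ V
  | .ex V φ => φ.fv \ V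

/-- The formula belongs to `L_{∞∞}`: every quantifier binds a set of variables. (The set of free
variables of a set of such formulae is then again a set.) -/
def Formula.IsInfInf : Formula L → Prop
  | .eq _ _ => True
  | .rel _ _ => True
  | .neg φ => φ.IsInfInf
  | .conj _ φ => ∀ i, (φ i).IsInfInf
  | .disj _ φ => ∀ i, (φ i).IsInfInf
  | .all V φ => Small.{u} V ∧ φ.IsInfInf
  | .ex V φ => Small.{u} V ∧ φ.IsInfInf

/-- The formula belongs to `L_{∞ω}`: every quantifier binds finitely many variables, and the
members of every conjunction and of every disjunction have, all together, only finitely many free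
variables. -/
def Formula.IsInfOmega : Formula L → Prop
  | .eq _ _ => True
  | .rel _ _ => True
  | .neg φ => φ.IsInfOmega
  | .conj _ φ => (⋃ i, (φ i).fv).Finite ∧ ∀ i, (φ i).IsInfOmega
  | .disj _ φ => (⋃ i, (φ i).fv).Finite ∧ ∀ i, (φ i).IsInfOmega
  | .all V φ => V.Finite ∧ φ.IsInfOmega
  | .ex V φ => V.Finite ∧ φ.IsInfOmega

/-- The logical symbols of the formula are among `¬`, `⋀`, `∀`. -/
def Formula.IsBasic : Formula L → Prop
  | .eq _ _ => True
  | .rel _ _ => True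
  | .neg φ => φ.IsBasic
  | .conj _ φ => ∀ i, (φ i).IsBasic
  | .disj _ _ => False
  | .all _ φ => φ.IsBasic
  | .ex _ _ => False

variable (L) in
/-- The class of `L_{∞∞}`-formulae. -/
def LInfInf : Set (Formula L) := {φ | φ.IsInfInf}

variable (L) in
/-- The class of `L_{∞ω}`-formulae. -/
def LInfOmega : Set (Formula L) := {φ | φ.IsInfOmega}

variable (L) in
/-- The class of formulae in `¬`, `⋀`, `∀`. -/
def Basic : Set (Formula L) := {φ | φ.IsBasic}

/-- Rewrites a formula in terms of `¬`, `⋀`, `∀`, reading `⋁ φ_i` as `¬ ⋀ ¬ φ_i` and `∃ V φ` as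
`¬ ∀ V ¬ φ`. -/
def Formula.basic : Formula L → Formula L
  | .eq s t => .eq s t
  | .rel R t => .rel R t
  | .neg φ => .neg φ.basic
  | .conj ι φ => .conj ι fun i => (φ i).basic
  | .disj ι φ => .neg (.conj ι fun i => .neg (φ i).basic)
  | .all V φ => .all V φ.basic
  | .ex V φ => .neg (.all V (.neg φ.basic))

/-! ### Substitution -/

open Classical in
/-- The simultaneous substitution `t ∕ V`, replacing each variable `x ∈ V` by `t x`. -/
noncomputable def repl (V : Set Var.{u}) (t : Var.{u} → Term L) : Var.{u} → Term L :=
  fun x => if x ∈ V then t x else .var x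

open Classical in
/-- The substitution that agrees with `σ` outside `V` and fixes the variables in `V`. -/
noncomputable def off (V : Set Var.{u}) (σ : Var.{u} → Term L) : Var.{u} → Term L :=
  fun x => if x ∈ V then .var x else σ x

/-- Substitution in a term. -/
def Term.subst (σ : Var.{u} → Term L) : Term L → Term L
  | .var x => σ x
  | .const c => .const c

/-- Simultaneous substitution for the free occurrences of the variables. -/
noncomputable def Formula.subst : (Var.{u} → Term L) → Formula L → Formula L
  | σ, .eq s t => .eq (s.subst σ) (t.subst σ)
  | σ, .rel R t => .rel R fun i => (t i).subst σ
  | σ, .neg φ => .neg (φ.subst σ)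
  | σ, .conj ι φ => .conj ι fun i => (φ i).subst σ
  | σ, .disj ι φ => .disj ι fun i => (φ i).subst σ
  | σ, .all V φ => .all V (φ.subst (off V σ))
  | σ, .ex V φ => .ex V (φ.subst (off V σ))

/-- The substitution `σ` is free for the formula: no variable of a substituted term is captured
by a quantifier. -/
def Formula.FreeFor : (Var.{u} → Term L) → Formula L → Prop
  | _, .eq _ _ => True
  | _, .rel _ _ => True
  | σ, .neg φ => φ.FreeFor σ
  | σ, .conj _ φ => ∀ i, (φ i).FreeFor σ
  | σ, .disj _ φ => ∀ i, (φ i).FreeFor σ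
  | σ, .all V φ => (∀ x ∈ φ.fv \ V, Disjoint (σ x).fv V) ∧ φ.FreeFor (off V σ)
  | σ, .ex V φ => (∀ x ∈ φ.fv \ V, Disjoint (σ x).fv V) ∧ φ.FreeFor (off V σ)

/-! ### Boolean valued semantics -/

/-- A `B`-valued model for `L`. -/
structure BVModel (L : Signature.{u}) (B : Type u) [CompleteBooleanAlgebra B] :
    Type (u + 1) where
  /-- the domain -/
  Carrier : Type u
  nonempty : Nonempty Carrier
  /-- the Boolean value of equality -/
  eqVal : Carrier → Carrier → B
  /-- the interpretation of the relation symbols -/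
  relVal : (R : L.Rel) → (Fin (L.arity R) → Carrier) → B
  /-- the interpretation of the constant symbols -/
  constVal : L.Const → Carrier
  eq_refl : ∀ a, eqVal a a = ⊤
  eq_symm : ∀ a b, eqVal a b = eqVal b a
  eq_trans : ∀ a b c, eqVal a b ⊓ eqVal b c ≤ eqVal a c
  rel_congr : ∀ (R : L.Rel) (a b : Fin (L.arity R) → Carrier),
    (⨅ i, eqVal (a i) (b i)) ⊓ relVal R a ≤ relVal R b

namespace BVModel

variable {B : Type u} [CompleteBooleanAlgebra B] (M : BVModel L B)

/-- The value of a term under an assignment. -/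
def termVal (v : Var.{u} → M.Carrier) : Term L → M.Carrier
  | .var x => v x
  | .const c => M.constVal c

open Classical in
/-- The assignment `v` changed to `a` on the variables in `V`. -/
noncomputable def update (v : Var.{u} → M.Carrier) (V : Set Var.{u}) (a : V → M.Carrier) :
    Var.{u} → M.Carrier :=
  fun x => if h : x ∈ V then a ⟨x, h⟩ else v x

/-- The Boolean value of a formula under an assignment. -/
noncomputable def val : (Var.{u} → M.Carrier) → Formula L → B
  | v, .eq s t => M.eqVal (M.termVal v s) (M.termVal v t)
  | v, .rel R t => M.relVal R fun i => M.termVal v (t i)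
  | v, .neg φ => (val v φ)ᶜ
  | v, .conj _ φ => ⨅ i, val v (φ i)
  | v, .disj _ φ => ⨆ i, val v (φ i)
  | v, .all V φ => ⨅ a : V → M.Carrier, val (M.update v V a) φ
  | v, .ex V φ => ⨆ a : V → M.Carrier, val (M.update v V a) φ

/-- The mixing property: any family of elements indexed by an antichain (a set of pairwise
incompatible elements of `B`) can be mixed. -/
def Mixing : Prop :=
  ∀ (A : Set B) (τ : A → M.Carrier), A.PairwiseDisjoint id →
    ∃ t : M.Carrier, ∀ a : A, (a : B) ≤ M.eqVal t (τ a)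

/-- `⋀ Γ ≤ ⋁ Δ` in `M`, under every assignment of the free variables. -/
def Satisfies (Γ Δ : Set (Formula L)) : Prop :=
  ∀ v : Var.{u} → M.Carrier, (⨅ φ ∈ Γ, M.val v φ) ≤ ⨆ φ ∈ Δ, M.val v φ

end BVModel

/-- `Γ ⊨_BVM Δ`: validity in all models with values in a complete Boolean algebra. -/
def EntailsBVM (Γ Δ : Set (Formula L)) : Prop :=
  ∀ (B : Type u) [CompleteBooleanAlgebra B] (M : BVModel L B), M.Satisfies Γ Δ

/-- `Γ ⊨_Sh Δ`: validity in all such models that have the mixing property. -/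
def EntailsSh (Γ Δ : Set (Formula L)) : Prop :=
  ∀ (B : Type u) [CompleteBooleanAlgebra B] (M : BVModel L B), M.Mixing → M.Satisfies Γ Δ

/-! ### The sequent calculus -/

variable (L) in
/-- A sequent `Γ ⊢ Δ` is the pair `(Γ, Δ)`. -/
abbrev Sequent : Type (u + 1) := Set (Formula L) × Set (Formula L)

/-- Both sides of the sequent are sets (as opposed to proper classes) of formulae from the
class `F`. -/
def Sequent.IsIn (F : Set (Formula L)) (s : Sequent L) : Prop :=
  (s.1 ⊆ F ∧ Small.{u} s.1) ∧ (s.2 ⊆ F ∧ Small.{u} s.2)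

/-- `Rule P s`: the sequent `s` is the conclusion of an instance of a rule of the calculus whose
premises are the sequents in `P`. -/
inductive Rule : Set (Sequent L) → Sequent L → Prop
  | ax (Γ Δ : Set (Formula L)) (φ : Formula L) :
      Rule ∅ (insert φ Γ, insert φ Δ)
  | cut (Γ Γ' Δ Δ' : Set (Formula L)) (φ : Formula L) :
      Rule {(insert φ Γ, Δ), (Γ', insert φ Δ')} (Γ ∪ Γ', Δ ∪ Δ')
  | substitution (Γ Δ : Set (Formula L)) (V : Set Var.{u}) (w : Var.{u} → Var.{u})
      (hV : Small.{u} V)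
      (hfree : ∀ ψ ∈ Γ ∪ Δ, ψ.FreeFor (repl V fun x => .var (w x))) :
      Rule {(Γ, Δ)}
        ((Formula.subst (repl V fun x => .var (w x))) '' Γ,
          (Formula.subst (repl V fun x => .var (w x))) '' Δ)
  | weakening (Γ Γ' Δ Δ' : Set (Formula L)) :
      Rule {(Γ, Δ)} (Γ ∪ Γ', Δ ∪ Δ')
  | negLeft (Γ Δ : Set (Formula L)) (φ : Formula L) :
      Rule {(Γ, insert φ Δ)} (insert φ.neg Γ, Δ)
  | negRight (Γ Δ : Set (Formula L)) (φ : Formula L) :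
      Rule {(insert φ Γ, Δ)} (Γ, insert φ.neg Δ)
  | conjLeft (Γ Δ : Set (Formula L)) (ι : Type u) (φ : ι → Formula L) :
      Rule {(Γ ∪ Set.range φ, Δ)} (insert (.conj ι φ) Γ, Δ)
  | conjRight (Γ Δ : Set (Formula L)) (ι : Type u) (φ : ι → Formula L) :
      Rule (Set.range fun i => (Γ, insert (φ i) Δ)) (Γ, insert (.conj ι φ) Δ)
  | allLeft (Γ Δ : Set (Formula L)) (V : Set Var.{u}) (φ : Formula L) (t : Var.{u} → Term L)
      (hfree : φ.FreeFor (repl V t)) :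
      Rule {(insert (φ.subst (repl V t)) Γ, Δ)} (insert (.all V φ) Γ, Δ)
  | allRight (Γ Δ : Set (Formula L)) (V : Set Var.{u}) (φ : Formula L) (w : Var.{u} → Var.{u})
      (hw : Set.InjOn w V)
      (hfresh : ∀ x ∈ V, ∀ ψ ∈ Γ ∪ Δ ∪ {φ}, w x ∉ ψ.fv)
      (hfree : φ.FreeFor (repl V fun x => .var (w x))) :
      Rule {(Γ, insert (φ.subst (repl V fun x => .var (w x))) Δ)} (Γ, insert (.all V φ) Δ)
  | eqRefl (t : Term L) :
      Rule ∅ (∅, {.eq t t})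
  | eqSymm (x y : Var.{u}) :
      Rule ∅ ({.eq (.var x) (.var y)}, {.eq (.var y) (.var x)})
  | eqSubst (V : Set Var.{u}) (s t : Var.{u} → Term L) (φ : Formula L)
      (hs : φ.FreeFor (repl V s)) (ht : φ.FreeFor (repl V t)) :
      Rule ∅ (insert (φ.subst (repl V t)) ((fun x => .eq (s x) (t x)) '' V),
        {φ.subst (repl V s)})

/-- The sequents that have a proof consisting of sequents of formulae from the class `F`. -/
inductive Provable (F : Set (Formula L)) : Sequent L → Prop
  | step (P : Set (Sequent L)) (s : Sequent L) (hrule : Rule P s) (hs : s.IsIn F)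
      (hP : ∀ p ∈ P, Provable F p) : Provable F s

/-- `Γ ⊢ Δ`, with a proof all of whose formulae belong to the class `F`. Sequents in proofs contain
only the logical symbols `¬`, `⋀`, `∀`; other formulae are first rewritten in these symbols. -/
def Proves (F : Set (Formula L)) (Γ Δ : Set (Formula L)) : Prop :=
  Provable (F ∩ Basic L) (Formula.basic '' Γ, Formula.basic '' Δ)

end BoolInf

/-! Each rule preserves validity in every Boolean valued model; the equality rule does so by
Leibniz's law `inf_val_le_val`. This gives 3 ⇒ 2, while 4 ⇒ 3 and 2 ⇒ 1 are inclusions of classes.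
The content is 1 ⇒ 4: a sequent `T ⊢ S` with no proof inside `L_{∞ω}` must fail in some mixing
model.

The model is built by forcing. A condition enlarges `T ⊢ S` by finitely many formulae on each side
so that it stays unprovable. The elements stand for terms, the algebra consists of the regular
down-sets of conditions, and the value of an atomic `φ` is the set of conditions whose sequent
becomes provable once `φ` is added on the right. This set is regular because a condition outside it
can be extended by `φ` on the right, which forces `¬φ` (`isRegular_forced`). The truth lemma
`coe_val` extends the description from atoms to all relevant formulae: infima of regular sets are
intersections, so it reduces to invertibility of the rules for `¬`, `⋀`, `∀`. The `∀` case needs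
fresh variables; they exist because a condition adds finitely many formulae, each with finitely many
free variables, while infinitely many variables are reserved (`exists_fresh`). Members of `T` then
get value `⊤`, members of `S` value `⊥`, and the unextended sequent is a condition, so `⊤ ≠ ⊥`.

Two obstacles remain. Terms must be substituted without capture, so free variables are first moved
above all bound ones (`provable_of_shift`). The forcing model need not be mixing, so it is replaced
by its completion by singletons; values in `L_{∞ω}` survive, since a finite tuple of singletons is
locally a tuple of old elements (`completion_val`). -/

namespace BoolInf

variable {L : Signature.{u}}

/-! ### Substitution and free variables -/

/-- The bound variables of a formula. -/
def Formula.bv : Formula L → Set Var.{u}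
  | .eq _ _ => ∅
  | .rel _ _ => ∅
  | .neg φ => φ.bv
  | .conj _ φ => ⋃ i, (φ i).bv
  | .disj _ φ => ⋃ i, (φ i).bv
  | .all V φ => V ∪ φ.bv
  | .ex V φ => V ∪ φ.bv

theorem off_of_mem {V : Set Var.{u}} {σ : Var.{u} → Term L} {x : Var.{u}} (h : x ∈ V) :
    off V σ x = .var x := if_pos h

theorem off_of_notMem {V : Set Var.{u}} {σ : Var.{u} → Term L} {x : Var.{u}} (h : x ∉ V) :
    off V σ x = σ x := if_neg h

theorem repl_of_mem {V : Set Var.{u}} {σ : Var.{u} → Term L} {x : Var.{u}} (h : x ∈ V) :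
    repl V σ x = σ x := if_pos h

theorem repl_of_notMem {V : Set Var.{u}} {σ : Var.{u} → Term L} {x : Var.{u}} (h : x ∉ V) :
    repl V σ x = .var x := if_neg h

theorem Term.subst_congr {σ τ : Var.{u} → Term L} (t : Term L) (h : ∀ x ∈ t.fv, σ x = τ x) :
    t.subst σ = t.subst τ := by
  cases t with
  | var x => exact h x rfl
  | const c => rfl

theorem Term.subst_var (t : Term L) : t.subst .var = t := by
  cases t <;> rfl

theorem Term.subst_subst (σ τ : Var.{u} → Term L) (t : Term L) :
    (t.subst σ).subst τ = t.subst fun x => (σ x).subst τ := by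
  cases t <;> rfl

theorem Term.mem_fv_subst {σ : Var.{u} → Term L} {t : Term L} {y : Var.{u}} :
    y ∈ (t.subst σ).fv ↔ ∃ x ∈ t.fv, y ∈ (σ x).fv := by
  cases t <;> simp [Term.subst, Term.fv]

theorem off_congr {V A : Set Var.{u}} {σ τ : Var.{u} → Term L} (h : ∀ x ∈ A \ V, σ x = τ x) :
    ∀ x ∈ A, off V σ x = off V τ x := by
  intro x hx
  by_cases hV : x ∈ V
  · rw [off_of_mem hV, off_of_mem hV]
  · rw [off_of_notMem hV, off_of_notMem hV, h x ⟨hx, hV⟩]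

theorem Formula.subst_congr {φ : Formula L} : ∀ {σ τ : Var.{u} → Term L},
    (∀ x ∈ φ.fv, σ x = τ x) → φ.subst σ = φ.subst τ := by
  induction φ with
  | eq s t =>
    intro σ τ h
    simp only [Formula.subst]
    rw [s.subst_congr fun x hx => h x (Or.inl hx), t.subst_congr fun x hx => h x (Or.inr hx)]
  | rel R t =>
    intro σ τ h
    simp only [Formula.subst]
    congr 1
    funext i
    exact (t i).subst_congr fun x hx => h x (Set.mem_iUnion.2 ⟨i, hx⟩)
  | neg φ ih =>
    intro σ τ h
    simp only [Formula.subst]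
    rw [ih h]
  | conj ι φ ih | disj ι φ ih =>
    intro σ τ h
    simp only [Formula.subst]
    congr 1
    funext i
    exact ih i fun x hx => h x (Set.mem_iUnion.2 ⟨i, hx⟩)
  | all V φ ih | ex V φ ih =>
    intro σ τ h
    simp only [Formula.subst]
    rw [ih (off_congr h)]

theorem off_var (V : Set Var.{u}) : off V (.var : Var.{u} → Term L) = .var := by
  funext x
  by_cases hV : x ∈ V
  · rw [off_of_mem hV]
  · rw [off_of_notMem hV]

theorem Formula.subst_var (φ : Formula L) : φ.subst .var = φ := by
  induction φ with
  | eq s t => simp only [Formula.subst, Term.subst_var]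
  | rel R t => simp only [Formula.subst, Term.subst_var]
  | neg φ ih => simp only [Formula.subst, ih]
  | conj ι φ ih | disj ι φ ih => simp only [Formula.subst, ih]
  | all V φ ih | ex V φ ih => simp only [Formula.subst, off_var, ih]

theorem Formula.mem_fv_subst {φ : Formula L} : ∀ {σ : Var.{u} → Term L} {y : Var.{u}},
    y ∈ (φ.subst σ).fv → ∃ x ∈ φ.fv, y ∈ (σ x).fv := by
  induction φ with
  | eq s t =>
    rintro σ y (h | h)
    · obtain ⟨x, hx, hy⟩ := Term.mem_fv_subst.1 h
      exact ⟨x, Or.inl hx, hy⟩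
    · obtain ⟨x, hx, hy⟩ := Term.mem_fv_subst.1 h
      exact ⟨x, Or.inr hx, hy⟩
  | rel R t =>
    intro σ y h
    obtain ⟨i, hi⟩ := Set.mem_iUnion.1 h
    obtain ⟨x, hx, hy⟩ := Term.mem_fv_subst.1 hi
    exact ⟨x, Set.mem_iUnion.2 ⟨i, hx⟩, hy⟩
  | neg φ ih => exact fun h => ih h
  | conj ι φ ih | disj ι φ ih =>
    intro σ y h
    obtain ⟨i, hi⟩ := Set.mem_iUnion.1 h
    obtain ⟨x, hx, hy⟩ := ih i hi
    exact ⟨x, Set.mem_iUnion.2 ⟨i, hx⟩, hy⟩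
  | all V φ ih | ex V φ ih =>
    rintro σ y ⟨h, hyV⟩
    obtain ⟨x, hx, hy⟩ := ih h
    by_cases hV : x ∈ V
    · rw [off_of_mem hV] at hy
      exact absurd (hy ▸ hV) hyV
    · rw [off_of_notMem hV] at hy
      exact ⟨x, ⟨hx, hV⟩, hy⟩

/-- Only the inner substitution has to be free for `φ`: below a quantifier over `V` its terms avoid
`V`, so shielding `V` from the outer substitution does not affect them. -/
theorem Formula.subst_subst {φ : Formula L} : ∀ {σ τ : Var.{u} → Term L}, φ.FreeFor σ →
    (φ.subst σ).subst τ = φ.subst fun x => (σ x).subst τ := by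
  induction φ with
  | eq s t =>
    intro σ τ _
    simp only [Formula.subst, Term.subst_subst]
  | rel R t =>
    intro σ τ _
    simp only [Formula.subst, Term.subst_subst]
  | neg φ ih =>
    intro σ τ h
    simp only [Formula.subst]
    rw [ih h]
  | conj ι φ ih | disj ι φ ih =>
    intro σ τ h
    simp only [Formula.subst]
    congr 1
    funext i
    exact ih i (h i)
  | all V φ ih | ex V φ ih =>
    intro σ τ h
    simp only [Formula.subst]
    rw [ih h.2]
    congr 1
    refine Formula.subst_congr fun x hx => ?_
    by_cases hV : x ∈ V
    · rw [off_of_mem hV, off_of_mem hV]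
      exact off_of_mem hV
    · rw [off_of_notMem hV, off_of_notMem hV]
      refine Term.subst_congr _ fun y hy => off_of_notMem fun hyV => ?_
      exact Set.disjoint_left.1 (h.1 x ⟨hx, hV⟩) hy hyV

/-- The alternative that a variable is fixed is what lets the induction pass a quantifier, since
`off V σ` fixes exactly the variables that `V` releases. -/
theorem Formula.freeFor_of_disjoint_bv {φ : Formula L} : ∀ {σ : Var.{u} → Term L},
    (∀ x ∈ φ.fv, σ x = .var x ∨ Disjoint (σ x).fv φ.bv) → φ.FreeFor σ := by
  induction φ with
  | eq s t => exact fun _ => trivial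
  | rel R t => exact fun _ => trivial
  | neg φ ih => exact fun h => ih h
  | conj ι φ ih | disj ι φ ih =>
    exact fun h i => ih i fun x hx => (h x (Set.mem_iUnion.2 ⟨i, hx⟩)).imp_right
      fun hd => hd.mono_right (Set.subset_iUnion (fun i => (φ i).bv) i)
  | all V φ ih | ex V φ ih =>
    intro σ h
    refine ⟨fun x hx => ?_, ih fun x hx => ?_⟩
    · rcases h x hx with h | h
      · rw [h]
        exact Set.disjoint_singleton_left.2 hx.2
      · exact h.mono_right Set.subset_union_left
    · by_cases hV : x ∈ V
      · exact Or.inl (off_of_mem hV)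
      · rw [off_of_notMem hV]
        exact (h x ⟨hx, hV⟩).imp_right fun hd => hd.mono_right Set.subset_union_right

theorem Formula.bv_subst {φ : Formula L} : ∀ {σ : Var.{u} → Term L},
    (φ.subst σ).bv = φ.bv := by
  induction φ with
  | eq s t => exact rfl
  | rel R t => exact rfl
  | neg φ ih => exact ih
  | conj ι φ ih | disj ι φ ih => exact Set.iUnion_congr fun i => ih i
  | all V φ ih | ex V φ ih => exact congrArg (V ∪ ·) ih

/-- A substitution that undoes a renaming of the free variables to variables which are not
bound is free for the renamed formula. -/
theorem Formula.freeFor_subst_of_leftInverse {φ : Formula L} :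
    ∀ {σ τ : Var.{u} → Term L}, (∀ x ∈ φ.fv, ∃ y ∉ φ.bv, σ x = .var y ∧ τ y = .var x) →
      (φ.subst σ).FreeFor τ := by
  -- Strengthened for the induction: a variable released by a quantifier is fixed by both
  -- substitutions, although it is bound in the whole formula.
  suffices H : ∀ {σ τ : Var.{u} → Term L},
      (∀ x ∈ φ.fv, ∃ y, (y = x ∨ y ∉ φ.bv) ∧ σ x = .var y ∧ τ y = .var x) →
      (φ.subst σ).FreeFor τ from
    fun {_ _} h => H fun x hx => (h x hx).imp fun y hy => ⟨Or.inr hy.1, hy.2⟩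
  induction φ with
  | eq s t => exact fun _ => trivial
  | rel R t => exact fun _ => trivial
  | neg φ ih => exact fun h => ih h
  | conj ι φ ih | disj ι φ ih =>
    exact fun h i => ih i fun x hx => (h x (Set.mem_iUnion.2 ⟨i, hx⟩)).imp fun y hy =>
      ⟨hy.1.imp_right fun hb hm => hb (Set.mem_iUnion.2 ⟨i, hm⟩), hy.2⟩
  | all V φ ih | ex V φ ih =>
    intro σ τ h
    refine ⟨?_, ih fun x hx => ?_⟩
    · rintro z ⟨hz, hzV⟩
      obtain ⟨x, hx, hzx⟩ := Formula.mem_fv_subst hz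
      by_cases hV : x ∈ V
      · rw [off_of_mem hV] at hzx
        exact absurd (hzx ▸ hV) hzV
      · rw [off_of_notMem hV] at hzx
        obtain ⟨y, -, hσ, hτ⟩ := h x ⟨hx, hV⟩
        rw [hσ] at hzx
        obtain rfl : z = y := hzx
        rw [hτ]
        exact Set.disjoint_singleton_left.2 hV
    · by_cases hV : x ∈ V
      · exact ⟨x, Or.inl rfl, off_of_mem hV, off_of_mem hV⟩
      · obtain ⟨y, hy, hσ, hτ⟩ := h x ⟨hx, hV⟩
        have hyV : y ∉ V := by
          rcases hy with rfl | hy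
          · exact hV
          · exact fun hm => hy (Or.inl hm)
        exact ⟨y, hy.imp_right fun hb hm => hb (Or.inr hm), by rw [off_of_notMem hV, hσ],
          by rw [off_of_notMem hyV, hτ]⟩

/-! ### Closure properties of the classes of formulae -/

theorem Term.finite_fv (t : Term L) : t.fv.Finite := by
  cases t with
  | var x => exact Set.finite_singleton x
  | const c => exact Set.finite_empty

theorem Formula.IsInfOmega.finite_fv {φ : Formula L} (h : φ.IsInfOmega) : φ.fv.Finite := by
  induction φ with
  | eq s t => exact s.finite_fv.union t.finite_fv
  | rel R t => exact Set.finite_iUnion fun i => (t i).finite_fv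
  | neg φ ih => exact ih h
  | conj ι φ ih | disj ι φ ih => exact h.1
  | all V φ ih | ex V φ ih => exact (ih h.2).sdiff

theorem Formula.IsInfOmega.isInfInf {φ : Formula L} (h : φ.IsInfOmega) : φ.IsInfInf := by
  induction φ with
  | eq s t => trivial
  | rel R t => trivial
  | neg φ ih => exact ih h
  | conj ι φ ih | disj ι φ ih => exact fun i => ih i (h.2 i)
  | all V φ ih | ex V φ ih =>
    have := h.1.to_subtype
    exact ⟨Countable.toSmall _, ih h.2⟩

theorem Formula.IsInfOmega.subst {φ : Formula L} (h : φ.IsInfOmega) :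
    ∀ σ : Var.{u} → Term L, (φ.subst σ).IsInfOmega := by
  have key : ∀ (ι : Type u) (φ : ι → Formula L) (σ : Var.{u} → Term L),
      (⋃ i, (φ i).fv).Finite → (⋃ i, ((φ i).subst σ).fv).Finite := by
    intro ι φ σ h
    refine (h.biUnion fun x _ => (σ x).finite_fv).subset (Set.iUnion_subset fun i y hy => ?_)
    obtain ⟨x, hx, hxy⟩ := Formula.mem_fv_subst hy
    exact Set.mem_biUnion (Set.mem_iUnion.2 ⟨i, hx⟩) hxy
  induction φ with
  | eq s t => exact fun _ => trivial
  | rel R t => exact fun _ => trivial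
  | neg φ ih => exact ih h
  | conj ι φ ih | disj ι φ ih => exact fun σ => ⟨key ι φ σ h.1, fun i => ih i (h.2 i) σ⟩
  | all V φ ih | ex V φ ih => exact fun σ => ⟨h.1, ih h.2 _⟩

theorem Formula.IsBasic.subst {φ : Formula L} (h : φ.IsBasic) :
    ∀ σ : Var.{u} → Term L, (φ.subst σ).IsBasic := by
  induction φ with
  | eq s t => exact fun _ => trivial
  | rel R t => exact fun _ => trivial
  | neg φ ih => exact ih h
  | conj ι φ ih => exact fun σ i => ih i (h i) σ
  | disj ι φ ih => exact h.elim
  | all V φ ih => exact fun σ => ih h _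
  | ex V φ ih => exact h.elim

theorem Formula.isBasic_basic (φ : Formula L) : φ.basic.IsBasic := by
  induction φ with
  | eq s t => trivial
  | rel R t => trivial
  | neg φ ih => exact ih
  | conj ι φ ih => exact ih
  | disj ι φ ih => exact ih
  | all V φ ih => exact ih
  | ex V φ ih => exact ih

theorem Formula.fv_basic (φ : Formula L) : φ.basic.fv = φ.fv := by
  induction φ with
  | eq s t => rfl
  | rel R t => rfl
  | neg φ ih => exact ih
  | conj ι φ ih | disj ι φ ih => exact Set.iUnion_congr ih
  | all V φ ih | ex V φ ih => exact congrArg (· \ V) ih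

theorem Formula.IsInfOmega.basic {φ : Formula L} (h : φ.IsInfOmega) : φ.basic.IsInfOmega := by
  induction φ with
  | eq s t => trivial
  | rel R t => trivial
  | neg φ ih => exact ih h
  | conj ι φ ih | disj ι φ ih =>
    refine ⟨?_, fun i => ih i (h.2 i)⟩
    have : (⋃ i, (φ i).basic.fv) = ⋃ i, (φ i).fv := Set.iUnion_congr fun i => (φ i).fv_basic
    exact this ▸ h.1
  | all V φ ih | ex V φ ih => exact ⟨h.1, ih h.2⟩

end BoolInf

namespace BoolInf

variable {L : Signature.{u}}

/-! ### Soundness -/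

namespace BVModel

variable {B : Type u} [CompleteBooleanAlgebra B] (M : BVModel L B)

theorem update_of_mem {v : Var.{u} → M.Carrier} {V : Set Var.{u}} {a : V → M.Carrier}
    {x : Var.{u}} (h : x ∈ V) : M.update v V a x = a ⟨x, h⟩ := dif_pos h

theorem update_of_notMem {v : Var.{u} → M.Carrier} {V : Set Var.{u}} {a : V → M.Carrier}
    {x : Var.{u}} (h : x ∉ V) : M.update v V a x = v x := dif_neg h

theorem termVal_congr {v v' : Var.{u} → M.Carrier} (t : Term L) (h : ∀ x ∈ t.fv, v x = v' x) :
    M.termVal v t = M.termVal v' t := by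
  cases t with
  | var x => exact h x rfl
  | const c => rfl

theorem update_congr {v v' : Var.{u} → M.Carrier} {A V : Set Var.{u}}
    (h : ∀ x ∈ A \ V, v x = v' x) (a : V → M.Carrier) :
    ∀ x ∈ A, M.update v V a x = M.update v' V a x := by
  intro x hx
  by_cases hV : x ∈ V
  · rw [update_of_mem _ hV, update_of_mem _ hV]
  · rw [update_of_notMem _ hV, update_of_notMem _ hV, h x ⟨hx, hV⟩]

theorem val_congr {φ : Formula L} : ∀ {v v' : Var.{u} → M.Carrier},
    (∀ x ∈ φ.fv, v x = v' x) → M.val v φ = M.val v' φ := by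
  induction φ with
  | eq s t =>
    intro v v' h
    simp only [val]
    rw [M.termVal_congr s fun x hx => h x (Or.inl hx),
      M.termVal_congr t fun x hx => h x (Or.inr hx)]
  | rel R t =>
    intro v v' h
    simp only [val]
    congr 1
    funext i
    exact M.termVal_congr (t i) fun x hx => h x (Set.mem_iUnion.2 ⟨i, hx⟩)
  | neg φ ih =>
    intro v v' h
    simp only [val]
    rw [ih h]
  | conj ι φ ih =>
    exact fun h => iInf_congr fun i => ih i fun x hx => h x (Set.mem_iUnion.2 ⟨i, hx⟩)
  | disj ι φ ih =>
    exact fun h => iSup_congr fun i => ih i fun x hx => h x (Set.mem_iUnion.2 ⟨i, hx⟩)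
  | all V φ ih => exact fun h => iInf_congr fun a => ih (M.update_congr h a)
  | ex V φ ih => exact fun h => iSup_congr fun a => ih (M.update_congr h a)

theorem termVal_subst (v : Var.{u} → M.Carrier) (σ : Var.{u} → Term L) (t : Term L) :
    M.termVal v (t.subst σ) = M.termVal (fun x => M.termVal v (σ x)) t := by
  cases t <;> rfl

theorem val_subst {φ : Formula L} : ∀ {v : Var.{u} → M.Carrier} {σ : Var.{u} → Term L},
    φ.FreeFor σ → M.val v (φ.subst σ) = M.val (fun x => M.termVal v (σ x)) φ := by
  have key : ∀ (V : Set Var.{u}) (φ : Formula L) (v : Var.{u} → M.Carrier)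
      (σ : Var.{u} → Term L) (a : V → M.Carrier),
      (∀ x ∈ φ.fv \ V, Disjoint (σ x).fv V) → ∀ x ∈ φ.fv,
      M.termVal (M.update v V a) (off V σ x) =
        M.update (fun x => M.termVal v (σ x)) V a x := by
    intro V φ v σ a h x hx
    by_cases hV : x ∈ V
    · rw [off_of_mem hV, update_of_mem _ hV]
      exact M.update_of_mem hV
    · rw [off_of_notMem hV, update_of_notMem _ hV]
      exact M.termVal_congr _ fun y hy =>
        M.update_of_notMem (Set.disjoint_left.1 (h x ⟨hx, hV⟩) hy)
  induction φ with
  | eq s t =>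
    intro v σ _
    simp only [val, Formula.subst, termVal_subst]
  | rel R t =>
    intro v σ _
    simp only [val, Formula.subst, termVal_subst]
  | neg φ ih =>
    intro v σ h
    simp only [val, Formula.subst]
    rw [ih h]
  | conj ι φ ih => exact fun h => iInf_congr fun i => ih i (h i)
  | disj ι φ ih => exact fun h => iSup_congr fun i => ih i (h i)
  | all V φ ih =>
    exact fun h => iInf_congr fun a => (ih h.2).trans (M.val_congr (key V φ _ _ a h.1))
  | ex V φ ih =>
    exact fun h => iSup_congr fun a => (ih h.2).trans (M.val_congr (key V φ _ _ a h.1))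

theorem le_eqVal_termVal {b : B} {v v' : Var.{u} → M.Carrier}
    (h : ∀ x, b ≤ M.eqVal (v x) (v' x)) (t : Term L) :
    b ≤ M.eqVal (M.termVal v t) (M.termVal v' t) := by
  cases t with
  | var x => exact h x
  | const c => exact le_top.trans (M.eq_refl _).ge

theorem le_eqVal_symm {b : B} {x y : M.Carrier} (h : b ≤ M.eqVal x y) : b ≤ M.eqVal y x :=
  M.eq_symm x y ▸ h

theorem le_eqVal_trans {b : B} {x y z : M.Carrier} (h : b ≤ M.eqVal x y)
    (h' : b ≤ M.eqVal y z) : b ≤ M.eqVal x z :=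
  (le_inf h h').trans (M.eq_trans x y z)

theorem le_eqVal_update {b : B} {v v' : Var.{u} → M.Carrier}
    (h : ∀ x, b ≤ M.eqVal (v x) (v' x)) (V : Set Var.{u}) (a : V → M.Carrier) (x : Var.{u}) :
    b ≤ M.eqVal (M.update v V a x) (M.update v' V a x) := by
  by_cases hV : x ∈ V
  · rw [update_of_mem _ hV, update_of_mem _ hV, M.eq_refl]
    exact le_top
  · rw [update_of_notMem _ hV, update_of_notMem _ hV]
    exact h x

/-- Leibniz's law, with one bound `b` for all variables at once so that quantifiers over infinite
sets cause no trouble. The negation case applies the induction hypothesis with the two assignments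
exchanged. -/
theorem inf_val_le_val {b : B} {φ : Formula L} : ∀ {v v' : Var.{u} → M.Carrier},
    (∀ x, b ≤ M.eqVal (v x) (v' x)) → b ⊓ M.val v φ ≤ M.val v' φ := by
  induction φ with
  | eq s t =>
    intro v v' h
    have hs := (inf_le_left (b := M.val v (.eq s t))).trans (M.le_eqVal_termVal h s)
    have ht := (inf_le_left (b := M.val v (.eq s t))).trans (M.le_eqVal_termVal h t)
    exact M.le_eqVal_trans (M.le_eqVal_trans (M.le_eqVal_symm hs) inf_le_right) ht
  | rel R t =>
    intro v v' h
    refine le_trans ?_ (M.rel_congr R (fun i => M.termVal v (t i)) _)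
    exact inf_le_inf_right _ (le_iInf fun i => M.le_eqVal_termVal h (t i))
  | neg φ ih =>
    intro v v' h
    have := ih (v := v') (v' := v) fun x => M.le_eqVal_symm (h x)
    change b ⊓ (M.val v φ)ᶜ ≤ (M.val v' φ)ᶜ
    rw [le_compl_iff_disjoint_right, disjoint_iff_inf_le]
    calc b ⊓ (M.val v φ)ᶜ ⊓ M.val v' φ ≤ M.val v φ ⊓ (M.val v φ)ᶜ :=
          le_inf ((inf_le_inf_right _ inf_le_left).trans this) (inf_le_left.trans inf_le_right)
      _ ≤ ⊥ := inf_compl_eq_bot.le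
  | conj ι φ ih =>
    exact fun h => le_iInf fun i => (inf_le_inf_left _ (iInf_le _ i)).trans (ih i h)
  | disj ι φ ih =>
    intro v v' h
    simp only [val]
    rw [inf_iSup_eq]
    exact iSup_mono fun i => ih i h
  | all V φ ih =>
    exact fun h => le_iInf fun a => (inf_le_inf_left _ (iInf_le _ a)).trans
      (ih (M.le_eqVal_update h V a))
  | ex V φ ih =>
    intro v v' h
    simp only [val]
    rw [inf_iSup_eq]
    exact iSup_mono fun a => ih (M.le_eqVal_update h V a)

theorem val_basic {φ : Formula L} : ∀ {v : Var.{u} → M.Carrier},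
    M.val v φ.basic = M.val v φ := by
  induction φ with
  | eq s t => exact rfl
  | rel R t => exact rfl
  | neg φ ih => exact congrArg compl ih
  | conj ι φ ih => exact iInf_congr fun i => ih i
  | disj ι φ ih =>
    intro v
    simp only [Formula.basic, val, compl_iInf, compl_compl]
    exact iSup_congr fun i => ih i
  | all V φ ih => exact iInf_congr fun a => ih
  | ex V φ ih =>
    intro v
    simp only [Formula.basic, val, compl_iInf, compl_compl]
    exact iSup_congr fun a => ih

theorem satisfies_basic {Γ Δ : Set (Formula L)} :
    M.Satisfies (Formula.basic '' Γ) (Formula.basic '' Δ) ↔ M.Satisfies Γ Δ := by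
  simp only [Satisfies, iInf_image, iSup_image, val_basic]

theorem satisfies_of_rule {P : Set (Sequent L)} {s : Sequent L} (h : Rule P s)
    (hP : ∀ p ∈ P, M.Satisfies p.1 p.2) : M.Satisfies s.1 s.2 := by
  intro v
  cases h with
  | ax Γ Δ φ =>
    exact (iInf₂_le φ (Set.mem_insert φ Γ)).trans
      (le_iSup₂ (f := fun ψ _ => M.val v ψ) φ (Set.mem_insert φ Δ))
  | cut Γ Γ' Δ Δ' φ =>
    have h₁ := hP _ (Or.inl rfl) v
    have h₂ := hP _ (Or.inr rfl) v
    simp only [iInf_insert, iSup_insert, iInf_union, iSup_union] at h₁ h₂ ⊢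
    calc _ ≤ (⨅ ψ ∈ Γ, M.val v ψ) ⊓ (M.val v φ ⊔ ⨆ ψ ∈ Δ', M.val v ψ) :=
          inf_le_inf_left _ h₂
      _ ≤ _ := by
          rw [inf_sup_left]
          exact sup_le_sup (by rwa [inf_comm]) inf_le_right
  | substitution Γ Δ V w hV hfree =>
    -- The conclusion at `v` is the premise at the assignment that reads each variable through the
    -- substitution.
    have h₁ := hP _ rfl fun x => M.termVal v (repl V (fun x => .var (w x)) x)
    simp only [iInf_image, iSup_image]
    refine (Eq.le ?_).trans (h₁.trans (Eq.le ?_))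
    · refine iInf_congr fun ψ => iInf_congr fun hψ => ?_
      exact M.val_subst (hfree ψ (Or.inl hψ))
    · refine iSup_congr fun ψ => iSup_congr fun hψ => ?_
      exact (M.val_subst (hfree ψ (Or.inr hψ))).symm
  | weakening Γ Γ' Δ Δ' =>
    have h₁ := hP _ rfl v
    simp only [iInf_union, iSup_union] at h₁ ⊢
    exact inf_le_left.trans (h₁.trans le_sup_left)
  | negLeft Γ Δ φ =>
    have h₁ := hP _ rfl v
    simp only [iInf_insert, iSup_insert, val] at h₁ ⊢
    rw [inf_comm, ← sdiff_eq, sdiff_le_iff]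
    exact h₁
  | negRight Γ Δ φ =>
    have h₁ := hP _ rfl v
    simp only [iInf_insert, iSup_insert, val] at h₁ ⊢
    rwa [sup_comm, ← himp_eq, le_himp_iff, inf_comm]
  | conjLeft Γ Δ ι φ =>
    have h₁ := hP _ rfl v
    simp only [iInf_insert, iInf_union, iInf_range, val] at h₁ ⊢
    rwa [inf_comm]
  | conjRight Γ Δ ι φ =>
    have h₁ := fun i => hP _ ⟨i, rfl⟩ v
    simp only [iSup_insert, val] at h₁ ⊢
    rw [iInf_sup_eq]
    exact le_iInf h₁
  | allLeft Γ Δ V φ t hfree =>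
    have h₁ := hP _ rfl v
    simp only [iInf_insert, val] at h₁ ⊢
    refine (inf_le_inf_right _ ?_).trans h₁
    rw [M.val_subst hfree]
    refine (iInf_le _ fun x : V => M.termVal v (t x)).trans (M.val_congr fun x _ => ?_).le
    by_cases hx : x ∈ V
    · rw [update_of_mem _ hx, repl_of_mem hx]
    · rw [update_of_notMem _ hx, repl_of_notMem hx]
      rfl
  | allRight Γ Δ V φ w hw hfresh hfree =>
    simp only [iSup_insert, val]
    rw [iInf_sup_eq]
    refine le_iInf fun a => ?_
    classical
    -- Stores the witness `a` in the fresh variables `w x`. Injectivity of `w` makes this well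
    -- defined, and freshness keeps the other values unchanged.
    let v' : Var.{u} → M.Carrier := fun y =>
      if h : ∃ x : V, w x = y then a h.choose else v y
    have hv' : ∀ x : V, v' (w x) = a x := by
      intro x
      have h : ∃ y : V, w y = w x := ⟨x, rfl⟩
      have : h.choose = x := Subtype.ext (hw h.choose.2 x.2 h.choose_spec)
      simp only [v', dif_pos h, this]
    have hv : ∀ ψ ∈ Γ ∪ Δ ∪ {φ}, ∀ y ∈ ψ.fv, v' y = v y := by
      intro ψ hψ y hy
      refine dif_neg ?_
      rintro ⟨x, rfl⟩
      exact hfresh x x.2 ψ hψ hy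
    have h₁ := hP _ rfl v'
    simp only [iSup_insert] at h₁
    refine (Eq.le ?_).trans (h₁.trans (sup_le_sup (Eq.le ?_) (Eq.le ?_)))
    · refine iInf_congr fun ψ => iInf_congr fun hψ => ?_
      exact M.val_congr fun y hy => (hv ψ (Or.inl (Or.inl hψ)) y hy).symm
    · rw [M.val_subst hfree]
      refine M.val_congr fun x hx => ?_
      by_cases hxV : x ∈ V
      · rw [update_of_mem _ hxV, repl_of_mem hxV]
        exact hv' ⟨x, hxV⟩
      · rw [update_of_notMem _ hxV, repl_of_notMem hxV]
        exact hv φ (Or.inr rfl) x hx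
    · refine iSup_congr fun ψ => iSup_congr fun hψ => ?_
      exact M.val_congr fun y hy => hv ψ (Or.inl (Or.inr hψ)) y hy
  | eqRefl t =>
    simp [val, M.eq_refl]
  | eqSymm x y =>
    simp [val, M.eq_symm (M.termVal v (.var x))]
  | eqSubst V s t φ hs ht =>
    simp only [iInf_insert, iInf_image, iSup_singleton, val]
    rw [M.val_subst hs, M.val_subst ht, inf_comm]
    refine M.inf_val_le_val fun x => ?_
    by_cases hx : x ∈ V
    · rw [repl_of_mem hx, repl_of_mem hx]
      exact M.le_eqVal_symm (iInf₂_le x hx)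
    · rw [repl_of_notMem hx, repl_of_notMem hx, M.eq_refl]
      exact le_top

end BVModel

theorem Provable.satisfies {F : Set (Formula L)} {s : Sequent L} (h : Provable F s)
    {B : Type u} [CompleteBooleanAlgebra B] (M : BVModel L B) : M.Satisfies s.1 s.2 := by
  induction h with
  | step P s hrule _ _ ih => exact M.satisfies_of_rule hrule ih

theorem Proves.entailsBVM {F Γ Δ : Set (Formula L)} (h : Proves F Γ Δ) : EntailsBVM Γ Δ :=
  fun _ _ M => M.satisfies_basic.1 (Provable.satisfies h M)

end BoolInf

namespace BoolInf

variable {L : Signature.{u}}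

/-! ### Derived rules -/

/-- `Γ` is a set (as opposed to a proper class) of formulae from the class `F`. -/
def SmallIn (F Γ : Set (Formula L)) : Prop := Γ ⊆ F ∧ Small.{u} Γ

namespace SmallIn

variable {F Γ Δ : Set (Formula L)}

theorem union (hΓ : SmallIn F Γ) (hΔ : SmallIn F Δ) : SmallIn F (Γ ∪ Δ) := by
  have := hΓ.2
  have := hΔ.2
  exact ⟨Set.union_subset hΓ.1 hΔ.1, inferInstance⟩

theorem insert (hΓ : SmallIn F Γ) {φ : Formula L} (hφ : φ ∈ F) : SmallIn F (insert φ Γ) := by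
  have := hΓ.2
  exact ⟨Set.insert_subset hφ hΓ.1, inferInstance⟩

theorem range {ι : Type u} {φ : ι → Formula L} (h : ∀ i, φ i ∈ F) : SmallIn F (Set.range φ) :=
  ⟨Set.range_subset_iff.2 h, inferInstance⟩

theorem of_finite (h : Γ.Finite) (hΓ : Γ ⊆ F) : SmallIn F Γ := by
  have := h.to_subtype
  exact ⟨hΓ, Countable.toSmall _⟩

end SmallIn

namespace Provable

variable {F Γ Γ' Δ Δ' : Set (Formula L)} {φ : Formula L}

theorem isIn {s : Sequent L} (h : Provable F s) : s.IsIn F := by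
  cases h with
  | step P s hrule hs hP => exact hs

theorem left (h : Provable F (Γ, Δ)) : SmallIn F Γ := h.isIn.1

theorem right (h : Provable F (Γ, Δ)) : SmallIn F Δ := h.isIn.2

theorem mono {F' : Set (Formula L)} (hF : F ⊆ F') {s : Sequent L} (h : Provable F s) :
    Provable F' s := by
  induction h with
  | step P s hrule hs hP ih =>
    exact .step P s hrule ⟨⟨hs.1.1.trans hF, hs.1.2⟩, hs.2.1.trans hF, hs.2.2⟩ ih

theorem weaken (h : Provable F (Γ, Δ)) (hΓ : Γ ⊆ Γ') (hΔ : Δ ⊆ Δ') (hΓ' : SmallIn F Γ')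
    (hΔ' : SmallIn F Δ') : Provable F (Γ', Δ') := by
  have := Rule.weakening Γ Γ' Δ Δ'
  rw [Set.union_eq_right.2 hΓ, Set.union_eq_right.2 hΔ] at this
  exact .step _ _ this ⟨hΓ', hΔ'⟩ (by rintro p rfl; exact h)

theorem of_mem (hΓ : SmallIn F Γ) (hΔ : SmallIn F Δ) (h : φ ∈ Γ) (h' : φ ∈ Δ) :
    Provable F (Γ, Δ) := by
  have := Rule.ax Γ Δ φ
  rw [Set.insert_eq_of_mem h, Set.insert_eq_of_mem h'] at this
  exact .step _ _ this ⟨hΓ, hΔ⟩ (by simp)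

theorem cut (h : Provable F (insert φ Γ, Δ)) (h' : Provable F (Γ, insert φ Δ)) :
    Provable F (Γ, Δ) := by
  have := Rule.cut Γ Γ Δ Δ φ
  rw [Set.union_self, Set.union_self] at this
  refine .step _ _ this ⟨h'.left, h.right⟩ ?_
  rintro p (rfl | rfl)
  · exact h
  · exact h'

/-- The rules are invertible by cut, here and in `conj_iff`. The truth lemma needs both directions.
-/
theorem neg_iff (hφ : φ ∈ F) (hn : φ.neg ∈ F) (hΓ : SmallIn F Γ) (hΔ : SmallIn F Δ) :
    Provable F (Γ, insert φ.neg Δ) ↔ Provable F (insert φ Γ, Δ) := by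
  refine ⟨fun h => ?_, fun h => .step _ _ (.negRight Γ Δ φ) ⟨hΓ, hΔ.insert hn⟩ ?_⟩
  · refine cut (φ := φ.neg) ?_ (h.weaken (Set.subset_insert _ _) subset_rfl (hΓ.insert hφ)
      (hΔ.insert hn))
    refine .step _ _ (.negLeft _ Δ φ) ⟨(hΓ.insert hφ).insert hn, hΔ⟩ ?_
    rintro p rfl
    exact of_mem (φ := φ) (hΓ.insert hφ) (hΔ.insert hφ) (Set.mem_insert _ _)
      (Set.mem_insert _ _)
  · rintro p rfl
    exact h

variable {ι : Type u} {f : ι → Formula L}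

theorem conj_intro (hc : .conj ι f ∈ F) (hΓ : SmallIn F Γ) (hΔ : SmallIn F Δ)
    (h : ∀ i, Provable F (Γ, insert (f i) Δ)) : Provable F (Γ, insert (.conj ι f) Δ) := by
  refine .step _ _ (.conjRight Γ Δ ι f) ⟨hΓ, hΔ.insert hc⟩ ?_
  rintro p ⟨i, rfl⟩
  exact h i

theorem conj_iff (hf : ∀ i, f i ∈ F) (hc : .conj ι f ∈ F) (hΓ : SmallIn F Γ)
    (hΔ : SmallIn F Δ) :
    Provable F (Γ, insert (.conj ι f) Δ) ↔ ∀ i, Provable F (Γ, insert (f i) Δ) := by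
  refine ⟨fun h i => ?_, conj_intro hc hΓ hΔ⟩
  refine cut (φ := .conj ι f) ?_ (h.weaken subset_rfl
    (Set.insert_subset_insert (Set.subset_insert _ _)) hΓ ((hΔ.insert (hf i)).insert hc))
  refine .step _ _ (.conjLeft Γ _ ι f) ⟨hΓ.insert hc, hΔ.insert (hf i)⟩ ?_
  rintro p rfl
  exact of_mem (φ := f i) (hΓ.union (.range hf)) (hΔ.insert (hf i)) (Or.inr ⟨i, rfl⟩)
    (Set.mem_insert _ _)

/-- Cut removes one formula at a time, so a whole family is cut through its conjunction, which must
therefore lie in `F`. -/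
theorem cut_range (hc : .conj ι f ∈ F) (hΓ : SmallIn F Γ)
    (h : Provable F (Γ ∪ Set.range f, Δ)) (h' : ∀ i, Provable F (Γ, insert (f i) Δ)) :
    Provable F (Γ, Δ) := by
  refine cut (φ := .conj ι f) (.step _ _ (.conjLeft Γ Δ ι f) ⟨hΓ.insert hc, h.right⟩ ?_)
    (conj_intro hc hΓ h.right h')
  rintro p rfl
  exact h

theorem all_elim {V : Set Var.{u}} {t : Var.{u} → Term L} (hfree : φ.FreeFor (repl V t))
    (hφ : φ.subst (repl V t) ∈ F) (hΔ : SmallIn F Δ)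
    (h : Provable F (Γ, insert (.all V φ) Δ)) :
    Provable F (Γ, insert (φ.subst (repl V t)) Δ) := by
  have ha : .all V φ ∈ F := h.right.1 (Set.mem_insert _ _)
  refine cut (φ := .all V φ) ?_ (h.weaken subset_rfl
    (Set.insert_subset_insert (Set.subset_insert _ _)) h.left ((hΔ.insert hφ).insert ha))
  refine .step _ _ (.allLeft Γ _ V φ t hfree) ⟨h.left.insert ha, hΔ.insert hφ⟩ ?_
  rintro p rfl
  exact of_mem (h.left.insert hφ) (hΔ.insert hφ) (Set.mem_insert _ _) (Set.mem_insert _ _)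

theorem all_intro {V : Set Var.{u}} {w : Var.{u} → Var.{u}} (hw : Set.InjOn w V)
    (hfresh : ∀ x ∈ V, ∀ ψ ∈ Γ ∪ Δ ∪ {φ}, w x ∉ ψ.fv)
    (hfree : φ.FreeFor (repl V fun x => .var (w x))) (ha : .all V φ ∈ F) (hΔ : SmallIn F Δ)
    (h : Provable F (Γ, insert (φ.subst (repl V fun x => .var (w x))) Δ)) :
    Provable F (Γ, insert (.all V φ) Δ) := by
  refine .step _ _ (.allRight Γ Δ V φ w hw hfresh hfree) ⟨h.left, hΔ.insert ha⟩ ?_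
  rintro p rfl
  exact h

end Provable

variable (L) in
/-- The class of `L_{∞ω}`-formulae in `¬`, `⋀`, `∀`. -/
def BasicInfOmega : Set (Formula L) := LInfOmega L ∩ Basic L

theorem subst_mem_basicInfOmega {φ : Formula L} (h : φ ∈ BasicInfOmega L)
    (σ : Var.{u} → Term L) : φ.subst σ ∈ BasicInfOmega L :=
  ⟨Formula.IsInfOmega.subst h.1 σ, Formula.IsBasic.subst h.2 σ⟩

/-- The substitution of the tuple `s` for the variables `v_0, …, v_{n-1}`. -/
noncomputable def tuple {n : ℕ} (s : Fin n → Term L) : Var.{u} → Term L :=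
  repl (Set.range fun i : Fin n => ((i : ℕ) : Ordinal.{u}))
    (Function.extend (fun i : Fin n => ((i : ℕ) : Ordinal.{u})) s .var)

theorem extend_natCast {n : ℕ} (s : Fin n → Term L) (i : Fin n) :
    Function.extend (fun i : Fin n => ((i : ℕ) : Ordinal.{u})) s .var ((i : ℕ) : Ordinal.{u}) =
      s i :=
  Function.Injective.extend_apply (fun _ _ h => Fin.ext (Nat.cast_injective h)) s _ i

theorem tuple_natCast {n : ℕ} (s : Fin n → Term L) (i : Fin n) :
    tuple s ((i : ℕ) : Ordinal.{u}) = s i :=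
  (repl_of_mem (Set.mem_range_self i)).trans (extend_natCast s i)

namespace Provable

variable {Γ Δ : Set (Formula L)}

/-- The equality axiom in context. The equations are removed together by `cut_range`; being finitely
many, they have a conjunction in `L_{∞ω}`. -/
theorem subst_tuple {n : ℕ} {s t : Fin n → Term L} {φ : Formula L} (hφ : φ ∈ BasicInfOmega L)
    (hfree : ∀ σ, φ.FreeFor σ) (hΔ : SmallIn (BasicInfOmega L) Δ)
    (hst : ∀ i, Provable (BasicInfOmega L) (Γ, insert (.eq (s i) (t i)) Δ))
    (h : Provable (BasicInfOmega L) (Γ, insert (φ.subst (tuple t)) Δ)) :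
    Provable (BasicInfOmega L) (Γ, insert (φ.subst (tuple s)) Δ) := by
  have hs := subst_mem_basicInfOmega hφ (tuple s)
  have ht := subst_mem_basicInfOmega hφ (tuple t)
  have he : ∀ i : ULift.{u} (Fin n), Formula.eq (s i.down) (t i.down) ∈ BasicInfOmega L :=
    fun _ => ⟨trivial, trivial⟩
  have hc : Formula.conj (ULift.{u} (Fin n)) (fun i => .eq (s i.down) (t i.down)) ∈
      BasicInfOmega L :=
    ⟨⟨Set.finite_iUnion fun i => Formula.IsInfOmega.finite_fv (he i).1, fun i => (he i).1⟩,
      fun i => (he i).2⟩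
  have hΓ := h.left.union (.range he)
  have sub : ∀ ψ : Formula L, insert ψ Δ ⊆ insert ψ (insert (φ.subst (tuple s)) Δ) :=
    fun ψ => Set.insert_subset_insert (Set.subset_insert _ _)
  refine cut_range hc h.left ?_ fun i =>
    (hst i.down).weaken subset_rfl (sub _) h.left ((hΔ.insert hs).insert (he i))
  refine cut (φ := φ.subst (tuple t)) ?_
    (h.weaken Set.subset_union_left (sub _) hΓ ((hΔ.insert hs).insert ht))
  have hr := Rule.eqSubst (Set.range fun i : Fin n => ((i : ℕ) : Ordinal.{u}))
    (Function.extend (fun i : Fin n => ((i : ℕ) : Ordinal.{u})) s .var)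
    (Function.extend (fun i : Fin n => ((i : ℕ) : Ordinal.{u})) t .var) φ (hfree _) (hfree _)
  rw [← Set.range_comp] at hr
  have hsub : Set.range ((fun x => Formula.eq
      (Function.extend (fun i : Fin n => ((i : ℕ) : Ordinal.{u})) s .var x)
      (Function.extend (fun i : Fin n => ((i : ℕ) : Ordinal.{u})) t .var x)) ∘
      fun i : Fin n => ((i : ℕ) : Ordinal.{u})) ⊆
      Set.range fun i : ULift.{u} (Fin n) => Formula.eq (s i.down) (t i.down) := by
    rintro _ ⟨i, rfl⟩
    exact ⟨⟨i⟩, by simp only [Function.comp, extend_natCast]⟩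
  refine weaken (.step _ _ hr ⟨?_, ?_⟩ (by simp))
    (Set.insert_subset_insert (hsub.trans Set.subset_union_right))
    (Set.singleton_subset_iff.2 (Set.mem_insert _ _)) (hΓ.insert ht) (hΔ.insert hs)
  · exact SmallIn.of_finite ((Set.finite_range _).insert _)
      (Set.insert_subset ht (hsub.trans (Set.range_subset_iff.2 he)))
  · exact SmallIn.of_finite (Set.finite_singleton _) (Set.singleton_subset_iff.2 hs)

theorem eq_refl (hΓ : SmallIn (BasicInfOmega L) Γ) (hΔ : SmallIn (BasicInfOmega L) Δ)
    (t : Term L) : Provable (BasicInfOmega L) (Γ, insert (.eq t t) Δ) := by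
  have he : Formula.eq t t ∈ BasicInfOmega L := ⟨trivial, trivial⟩
  refine weaken (.step _ _ (.eqRefl t) ⟨?_, ?_⟩ (by simp)) (Set.empty_subset _)
    (Set.singleton_subset_iff.2 (Set.mem_insert _ _)) hΓ (hΔ.insert he)
  · exact SmallIn.of_finite Set.finite_empty (Set.empty_subset _)
  · exact SmallIn.of_finite (Set.finite_singleton _) (Set.singleton_subset_iff.2 he)

theorem eq_subst {a b c d : Term L} (hΔ : SmallIn (BasicInfOmega L) Δ)
    (ha : Provable (BasicInfOmega L) (Γ, insert (.eq a c) Δ))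
    (hb : Provable (BasicInfOmega L) (Γ, insert (.eq b d) Δ))
    (h : Provable (BasicInfOmega L) (Γ, insert (.eq c d) Δ)) :
    Provable (BasicInfOmega L) (Γ, insert (.eq a b) Δ) := by
  have := subst_tuple (Γ := Γ) (Δ := Δ) (s := ![a, b]) (t := ![c, d])
    (φ := .eq (.var ((0 : Fin 2) : ℕ)) (.var ((1 : Fin 2) : ℕ))) ⟨trivial, trivial⟩
    (fun _ => trivial) hΔ (Fin.forall_fin_two.2 ⟨ha, hb⟩)
  simp only [Formula.subst, Term.subst, tuple_natCast] at this
  exact this h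

/-- Replace the left `b` of `b = b` by itself and the right one by `a`; this covers all terms,
whereas the symmetry rule speaks of variables. -/
theorem eq_symm {a b : Term L} (hΔ : SmallIn (BasicInfOmega L) Δ)
    (h : Provable (BasicInfOmega L) (Γ, insert (.eq a b) Δ)) :
    Provable (BasicInfOmega L) (Γ, insert (.eq b a) Δ) :=
  have hr := eq_refl h.left hΔ b
  eq_subst hΔ hr h hr

theorem eq_trans {a b c : Term L} (hΔ : SmallIn (BasicInfOmega L) Δ)
    (h : Provable (BasicInfOmega L) (Γ, insert (.eq a b) Δ))
    (h' : Provable (BasicInfOmega L) (Γ, insert (.eq b c) Δ)) :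
    Provable (BasicInfOmega L) (Γ, insert (.eq a c) Δ) :=
  eq_subst hΔ h (eq_refl h.left hΔ c) h'

theorem rel_congr {R : L.Rel} {a b : Fin (L.arity R) → Term L}
    (hΔ : SmallIn (BasicInfOmega L) Δ)
    (hab : ∀ i, Provable (BasicInfOmega L) (Γ, insert (.eq (a i) (b i)) Δ))
    (h : Provable (BasicInfOmega L) (Γ, insert (.rel R a) Δ)) :
    Provable (BasicInfOmega L) (Γ, insert (.rel R b) Δ) := by
  have := subst_tuple (Γ := Γ) (Δ := Δ) (s := b) (t := a)
    (φ := .rel R fun i => .var ((i : ℕ) : Ordinal.{u})) ⟨trivial, trivial⟩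
    (fun _ => trivial) hΔ (fun i => eq_symm hΔ (hab i))
  simp only [Formula.subst, Term.subst, tuple_natCast] at this
  exact this h

end Provable

end BoolInf

namespace BoolInf

variable {L : Signature.{u}}

/-! ### Mixing completion -/

namespace BVModel

variable {B : Type u} [CompleteBooleanAlgebra B] (M : BVModel L B)

/-- The singletons of the Boolean valued set `M`: extensional functions on `M` that describe
exactly one element. -/
structure Singleton : Type u where
  /-- the Boolean value of being the element described -/
  toFun : M.Carrier → B
  ext : ∀ m m', toFun m ⊓ M.eqVal m m' ≤ toFun m'
  unique : ∀ m m', toFun m ⊓ toFun m' ≤ M.eqVal m m'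
  total : ⨆ m, toFun m = ⊤

namespace Singleton

variable {M}

/-- The singleton of an element. -/
def of (m : M.Carrier) : M.Singleton where
  toFun := M.eqVal m
  ext := M.eq_trans m
  unique a b := by
    rw [M.eq_symm m a]
    exact M.eq_trans a m b
  total := top_le_iff.1 ((M.eq_refl m).ge.trans (le_iSup (M.eqVal m) m))

/-- The Boolean value of the equality of two singletons. -/
def eqVal (f g : M.Singleton) : B := ⨆ m, f.toFun m ⊓ g.toFun m

theorem eqVal_comm (f g : M.Singleton) : eqVal f g = eqVal g f :=
  iSup_congr fun _ => inf_comm _ _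

theorem eqVal_self (f : M.Singleton) : eqVal f f = ⊤ := by
  simp only [eqVal, inf_idem, f.total]

/-- Where `f` and `g` share an element `m'`, uniqueness for `f` identifies it with `m`, and
extensionality of `g` carries `g` over to `m`. -/
theorem inf_eqVal_le (f g : M.Singleton) (m : M.Carrier) :
    f.toFun m ⊓ eqVal f g ≤ g.toFun m := by
  rw [eqVal, inf_iSup_eq]
  refine iSup_le fun m' => ?_
  rw [← inf_assoc]
  refine le_trans ?_ (g.ext m' m)
  rw [M.eq_symm m' m]
  exact le_inf inf_le_right (inf_le_left.trans (f.unique m m'))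

theorem eqVal_of (f : M.Singleton) (m : M.Carrier) : eqVal f (of m) = f.toFun m := by
  refine le_antisymm (iSup_le fun m' => ?_) ?_
  · refine le_trans ?_ (f.ext m' m)
    rw [M.eq_symm m' m]
    exact le_rfl
  · refine le_trans ?_ (le_iSup _ m)
    exact le_inf le_rfl (le_top.trans (M.eq_refl m).ge)

/-- The mixture is `m ↦ ⨆ i, c i ⊓ σ i m`. Disjointness of the `c i` gives uniqueness, and their
join being `⊤` gives totality. -/
theorem exists_mix {ι : Type*} {c : ι → B} (hc : Pairwise (Function.onFun Disjoint c))
    (hc' : ⨆ i, c i = ⊤) (σ : ι → M.Singleton) :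
    ∃ f : M.Singleton, ∀ i, c i ≤ eqVal f (σ i) := by
  refine ⟨⟨fun m => ⨆ i, c i ⊓ (σ i).toFun m, fun m m' => ?_, fun m m' => ?_, ?_⟩, fun i => ?_⟩
  · rw [iSup_inf_eq]
    refine iSup_mono fun i => ?_
    rw [inf_assoc]
    exact inf_le_inf_left _ ((σ i).ext m m')
  · rw [iSup_inf_eq]
    refine iSup_le fun i => ?_
    rw [inf_iSup_eq]
    refine iSup_le fun j => ?_
    by_cases h : i = j
    · subst h
      exact (inf_le_inf inf_le_right inf_le_right).trans ((σ i).unique m m')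
    · exact (inf_le_inf inf_le_left inf_le_left).trans ((hc h).le_bot.trans bot_le)
  · rw [iSup_comm]
    simp only [← inf_iSup_eq, (σ _).total, inf_top_eq, hc']
  · calc c i = ⨆ m, c i ⊓ (σ i).toFun m := by rw [← inf_iSup_eq, (σ i).total, inf_top_eq]
      _ ≤ _ := iSup_mono fun m =>
        le_inf (le_iSup (fun j => c j ⊓ (σ j).toFun m) i) inf_le_right

end Singleton

/-- The completion of `M` under mixing. -/
def completion : BVModel L B where
  Carrier := M.Singleton
  nonempty := M.nonempty.map Singleton.of
  eqVal := Singleton.eqVal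
  -- The least extension of the relation from `M` that respects equality.
  relVal R f := ⨆ m : Fin (L.arity R) → M.Carrier, (⨅ i, (f i).toFun (m i)) ⊓ M.relVal R m
  constVal c := Singleton.of (M.constVal c)
  eq_refl := Singleton.eqVal_self
  eq_symm := Singleton.eqVal_comm
  eq_trans f g h := by
    rw [Singleton.eqVal, iSup_inf_eq]
    refine iSup_mono fun m => ?_
    rw [inf_assoc]
    exact inf_le_inf_left _ (Singleton.inf_eqVal_le g h m)
  rel_congr R a b := by
    rw [inf_iSup_eq]
    refine iSup_mono fun m => ?_
    rw [← inf_assoc]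
    refine inf_le_inf_right _ (le_iInf fun i => le_trans ?_ (Singleton.inf_eqVal_le (a i) (b i) _))
    exact le_inf (inf_le_right.trans (iInf_le _ i)) (inf_le_left.trans (iInf_le _ i))

theorem completion_mixing : M.completion.Mixing := by
  intro A τ hA
  obtain ⟨m₀⟩ := M.nonempty
  -- The antichain becomes a partition of unity by adding the complement of its join; the element
  -- mixed in there is arbitrary.
  let c : Option A → B := fun o => o.elim (⨆ a : A, (a : B))ᶜ fun a => a
  have hd : ∀ a : A, Disjoint (a : B) (⨆ a : A, (a : B))ᶜ := fun a =>
    disjoint_compl_right.mono_left (le_iSup (fun a : A => (a : B)) a)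
  have hc : Pairwise (Function.onFun Disjoint c) := by
    rintro (_ | a) (_ | b) hab
    · exact absurd rfl hab
    · exact (hd b).symm
    · exact hd a
    · exact hA a.2 b.2 fun h => hab (congrArg some (Subtype.ext h))
  have hc' : ⨆ i, c i = ⊤ := by
    rw [iSup_option, sup_comm]
    exact sup_compl_eq_top
  obtain ⟨f, hf⟩ := Singleton.exists_mix hc hc' fun o => o.elim (Singleton.of m₀) τ
  exact ⟨f, fun a => hf (some a)⟩

/-- The embedding of `M` into its completion. -/
def toCompletion (m : M.Carrier) : M.completion.Carrier := Singleton.of m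

theorem completion_eqVal (m m' : M.Carrier) :
    M.completion.eqVal (M.toCompletion m) (M.toCompletion m') = M.eqVal m m' :=
  Singleton.eqVal_of _ _

theorem iSup_completion_eqVal (f : M.completion.Carrier) :
    ⨆ m, M.completion.eqVal f (M.toCompletion m) = ⊤ :=
  (iSup_congr fun m => Singleton.eqVal_of f m).trans (Singleton.total f)

theorem completion_termVal (v : Var.{u} → M.Carrier) (t : Term L) :
    M.completion.termVal (fun x => M.toCompletion (v x)) t = M.toCompletion (M.termVal v t) := by
  cases t <;> rfl

theorem completion_relVal (R : L.Rel) (m : Fin (L.arity R) → M.Carrier) :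
    M.completion.relVal R (fun i => M.toCompletion (m i)) = M.relVal R m := by
  refine le_antisymm (iSup_le fun m' => ?_)
    (le_trans ?_ (le_iSup (fun m' => (⨅ i, M.eqVal (m i) (m' i)) ⊓ M.relVal R m') m))
  · refine le_trans (inf_le_inf_right _ ?_) (M.rel_congr R m' m)
    exact iInf_mono fun i => (M.eq_symm _ _).le
  · exact le_inf (le_iInf fun i => le_top.trans (M.eq_refl _).ge) le_rfl

/-- Only `∀` is at stake, as the completion has more elements to range over. The old ones are dense
by `iSup_completion_eqVal`, so Leibniz's law bounds the value at a new tuple from below by the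
infimum over old tuples. -/
theorem completion_val {φ : Formula L} (hφ : φ ∈ BasicInfOmega L) :
    ∀ v : Var.{u} → M.Carrier,
      M.completion.val (fun x => M.toCompletion (v x)) φ = M.val v φ := by
  obtain ⟨hω, hb⟩ := hφ
  induction φ with
  | eq s t =>
    intro v
    simp only [val, completion_termVal, completion_eqVal]
  | rel R t =>
    intro v
    simp only [val, completion_termVal, completion_relVal]
  | neg φ ih => exact fun v => congrArg compl (ih hω hb v)
  | conj ι φ ih => exact fun v => iInf_congr fun i => ih i (hω.2 i) (hb i) v
  | disj ι φ ih => exact hb.elim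
  | ex V φ ih => exact hb.elim
  | all V φ ih =>
    intro v
    have hu : ∀ a : V → M.Carrier, M.completion.update (fun x => M.toCompletion (v x)) V
        (fun x => M.toCompletion (a x)) = fun x => M.toCompletion (M.update v V a x) := by
      intro a
      funext x
      by_cases hx : x ∈ V
      · rw [update_of_mem _ hx, update_of_mem _ hx]
      · rw [update_of_notMem _ hx, update_of_notMem _ hx]
    simp only [val]
    refine le_antisymm (le_iInf fun a => ?_) (le_iInf fun f => ?_)
    · rw [← ih hω.2 hb, ← hu]
      exact iInf_le (fun f => M.completion.val (M.completion.update _ V f) φ)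
        fun x => M.toCompletion (a x)
    · have := hω.1.to_subtype
      -- Finiteness of `V` enters here: a finite meet of joins is a join of meets over choice
      -- functions.
      have htop : ⨆ m : V → M.Carrier, ⨅ x, M.completion.eqVal (f x) (M.toCompletion (m x)) =
          ⊤ := by
        refine (iInf_iSup_eq_of_finite
          (f := fun x m => M.completion.eqVal (f x) (M.toCompletion m))).symm.trans ?_
        simp only [iSup_completion_eqVal, iInf_top]
      rw [← inf_top_eq (⨅ a, _), ← htop, inf_iSup_eq]
      refine iSup_le fun m => ?_
      rw [inf_comm]
      refine (inf_le_inf_left _ (iInf_le _ m)).trans ?_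
      rw [← ih hω.2 hb, ← hu]
      refine M.completion.inf_val_le_val fun x => ?_
      by_cases hx : x ∈ V
      · rw [update_of_mem _ hx, update_of_mem _ hx, M.completion.eq_symm]
        exact iInf_le _ (⟨x, hx⟩ : V)
      · rw [update_of_notMem _ hx, update_of_notMem _ hx, M.completion.eq_refl]
        exact le_top

end BVModel

end BoolInf

/-! ### Regular elements of a frame and pseudocomplements of down-sets -/

namespace Heyting.Regular

/-- The regular elements of a frame form a complete Boolean algebra. -/
noncomputable instance {α : Type*} [Order.Frame α] : CompleteBooleanAlgebra (Regular α) :=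
  { (inferInstance : BooleanAlgebra (Regular α)), gi.liftCompleteLattice with }

/-- The inclusion of the regular elements is right adjoint to double negation, hence preserves
infima. -/
theorem coe_iInf {α : Type*} [Order.Frame α] {ι : Sort*} (f : ι → Regular α) :
    ((⨅ i, f i : Regular α) : α) = ⨅ i, (f i : α) :=
  gi.gc.u_iInf

end Heyting.Regular

/-- The forcing clause for negation. -/
theorem LowerSet.mem_himp_compl_iff {α : Type*} [Preorder α] {s : LowerSet α} {a : α} :
    a ∈ sᶜ ↔ ∀ b ≤ a, b ∉ s := by
  rw [← LowerSet.Iic_le, le_compl_iff_disjoint_right, disjoint_iff_inf_le]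
  exact ⟨fun h b hb hs => h ⟨hb, hs⟩, fun h b hb => h b hb.1 hb.2⟩

namespace BoolInf

variable {L : Signature.{u}}

/-! ### The forcing model of an unprovable sequent -/

/-- The subformulae of a formula. -/
def Formula.sub : Formula L → Set (Formula L)
  | .eq s t => {.eq s t}
  | .rel R t => {.rel R t}
  | .neg φ => insert φ.neg φ.sub
  | .conj ι φ => insert (.conj ι φ) (⋃ i, (φ i).sub)
  | .disj ι φ => insert (.disj ι φ) (⋃ i, (φ i).sub)
  | .all V φ => insert (.all V φ) φ.sub
  | .ex V φ => insert (.ex V φ) φ.sub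

theorem Formula.mem_sub (φ : Formula L) : φ ∈ φ.sub := by
  cases φ <;> first | exact Or.inl rfl | exact rfl

/-- The data from which a forcing model refuting the sequent `T ⊢ S` is built: a set of formulae
to occur in the conditions, and a set of terms to be the elements. -/
structure Refutation (T S : Set (Formula L)) : Type (u + 1) where
  left : SmallIn (BasicInfOmega L) T
  right : SmallIn (BasicInfOmega L) S
  not_provable : ¬ Provable (BasicInfOmega L) (T, S)
  /-- the codes of the formulae -/
  Code : Type u
  /-- the formula with a given code -/
  formula : Code → Formula L
  formula_mem : ∀ i, formula i ∈ BasicInfOmega L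
  /-- the elements -/
  Elem : Type u
  /-- the term that an element stands for -/
  term : Elem → Term L
  exists_const : ∀ c, ∃ d, term d = .const c
  eq_mem : ∀ d d', .eq (term d) (term d') ∈ Set.range formula
  rel_mem : ∀ (R : L.Rel) (a : Fin (L.arity R) → Elem),
    .rel R (fun i => term (a i)) ∈ Set.range formula
  infinite_fresh : {y | (∃ d, term d = .var y) ∧ ∀ ψ ∈ T ∪ S, y ∉ ψ.fv}.Infinite

namespace Refutation

variable {T S : Set (Formula L)} (H : Refutation T S)

/-- The forcing conditions: finite consistent extensions of the sequent. -/
structure Condition : Type u where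
  /-- the formulae added on the left -/
  pos : Set H.Code
  /-- the formulae added on the right -/
  neg : Set H.Code
  pos_finite : pos.Finite
  neg_finite : neg.Finite
  consistent : ¬ Provable (BasicInfOmega L) (H.formula '' pos ∪ T, H.formula '' neg ∪ S)

variable {H}

namespace Condition

instance : Preorder H.Condition :=
  Preorder.lift fun p => OrderDual.toDual (p.pos, p.neg)

theorem le_iff {p q : H.Condition} : p ≤ q ↔ q.pos ⊆ p.pos ∧ q.neg ⊆ p.neg := Iff.rfl

variable (p : H.Condition)

/-- The left side of the sequent given by a condition. -/
def lhs : Set (Formula L) := H.formula '' p.pos ∪ T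

/-- The right side of the sequent given by a condition. -/
def rhs : Set (Formula L) := H.formula '' p.neg ∪ S

theorem smallIn_image {s : Set H.Code} : SmallIn (BasicInfOmega L) (H.formula '' s) :=
  ⟨Set.image_subset_iff.2 fun i _ => H.formula_mem i, inferInstance⟩

theorem smallIn_lhs : SmallIn (BasicInfOmega L) p.lhs := smallIn_image.union H.left

theorem smallIn_rhs : SmallIn (BasicInfOmega L) p.rhs := smallIn_image.union H.right

theorem lhs_anti {p q : H.Condition} (h : p ≤ q) : q.lhs ⊆ p.lhs :=
  Set.union_subset_union_left _ (Set.image_mono h.1)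

theorem rhs_anti {p q : H.Condition} (h : p ≤ q) : q.rhs ⊆ p.rhs :=
  Set.union_subset_union_left _ (Set.image_mono h.2)

theorem not_provable : ¬ Provable (BasicInfOmega L) (p.lhs, p.rhs) := p.consistent

theorem exists_insert_lhs (i : H.Code)
    (h : ¬ Provable (BasicInfOmega L) (insert (H.formula i) p.lhs, p.rhs)) :
    ∃ q ≤ p, H.formula i ∈ q.lhs := by
  refine ⟨⟨insert i p.pos, p.neg, p.pos_finite.insert i, p.neg_finite, ?_⟩,
    le_iff.2 ⟨Set.subset_insert _ _, subset_rfl⟩, Or.inl ⟨i, Set.mem_insert _ _, rfl⟩⟩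
  rwa [Set.image_insert_eq, Set.insert_union]

theorem exists_insert_rhs (i : H.Code)
    (h : ¬ Provable (BasicInfOmega L) (p.lhs, insert (H.formula i) p.rhs)) :
    ∃ q ≤ p, H.formula i ∈ q.rhs := by
  refine ⟨⟨p.pos, insert i p.neg, p.pos_finite, p.neg_finite.insert i, ?_⟩,
    le_iff.2 ⟨subset_rfl, Set.subset_insert _ _⟩, Or.inl ⟨i, Set.mem_insert _ _, rfl⟩⟩
  rwa [Set.image_insert_eq, Set.insert_union]

end Condition

variable (H) in
/-- The conditions that force a formula. -/
def forced (φ : Formula L) (hφ : φ ∈ BasicInfOmega L) : LowerSet H.Condition where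
  carrier := {p | Provable (BasicInfOmega L) (p.lhs, insert φ p.rhs)}
  lower' := fun _ q hqp hp => hp.weaken (Condition.lhs_anti hqp)
    (Set.insert_subset_insert (Condition.rhs_anti hqp)) q.smallIn_lhs (q.smallIn_rhs.insert hφ)

/-- If the sequent with `φ` on the left is unprovable, adding `φ` there gives a stronger condition
that forces `φ`. If it is provable, a stronger condition forcing `φ` would be inconsistent by cut.
-/
theorem mem_compl_forced {φ : Formula L} {hφ : φ ∈ BasicInfOmega L}
    (hc : φ ∈ Set.range H.formula) {p : H.Condition} :
    p ∈ (H.forced φ hφ)ᶜ ↔ Provable (BasicInfOmega L) (insert φ p.lhs, p.rhs) := by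
  rw [LowerSet.mem_himp_compl_iff]
  refine ⟨fun h => ?_, fun h q hq hf => ?_⟩
  · by_contra hn
    obtain ⟨i, rfl⟩ := hc
    obtain ⟨q, hq, hm⟩ := p.exists_insert_lhs i hn
    exact h q hq (Provable.of_mem q.smallIn_lhs (q.smallIn_rhs.insert hφ) hm
      (Set.mem_insert _ _))
  · exact q.not_provable (Provable.cut (h.weaken
      (Set.insert_subset_insert (Condition.lhs_anti hq)) (Condition.rhs_anti hq)
      (q.smallIn_lhs.insert hφ) q.smallIn_rhs) hf)

theorem isRegular_forced {φ : Formula L} {hφ : φ ∈ BasicInfOmega L}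
    (hc : φ ∈ Set.range H.formula) : Heyting.IsRegular (H.forced φ hφ) := by
  refine le_antisymm (fun p hp => ?_) le_compl_compl
  replace hp := LowerSet.mem_himp_compl_iff.1 hp
  by_contra hn
  have hc' := hc
  obtain ⟨i, rfl⟩ := hc'
  obtain ⟨q, hq, hm⟩ := p.exists_insert_rhs i hn
  exact hp q hq ((mem_compl_forced hc).2 (Provable.of_mem (q.smallIn_lhs.insert hφ)
    q.smallIn_rhs (Set.mem_insert _ _) hm))

variable (H) in
/-- The Boolean value of a formula that has a code. -/
def value (φ : Formula L) (hc : φ ∈ Set.range H.formula) :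
    Heyting.Regular (LowerSet H.Condition) :=
  ⟨H.forced φ (Set.range_subset_iff.2 H.formula_mem hc), isRegular_forced hc⟩

theorem exists_var : ∃ y d, H.term d = .var y := by
  obtain ⟨y, hy, -⟩ := H.infinite_fresh.nonempty
  exact ⟨y, hy⟩

variable (H) in
/-- The forcing model. -/
noncomputable def model : BVModel L (Heyting.Regular (LowerSet H.Condition)) where
  Carrier := H.Elem
  nonempty := ⟨H.exists_var.choose_spec.choose⟩
  eqVal a b := H.value _ (H.eq_mem a b)
  relVal R a := H.value _ (H.rel_mem R a)
  constVal c := (H.exists_const c).choose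
  eq_refl a := top_le_iff.1 fun p _ => Provable.eq_refl p.smallIn_lhs p.smallIn_rhs _
  eq_symm a b := le_antisymm (fun p hp => Provable.eq_symm p.smallIn_rhs hp)
    (fun p hp => Provable.eq_symm p.smallIn_rhs hp)
  eq_trans a b c := fun p hp => Provable.eq_trans p.smallIn_rhs hp.1 hp.2
  rel_congr R a b := by
    intro p hp
    have h : p ∈ ((⨅ i, H.value _ (H.eq_mem (a i) (b i)) :
      Heyting.Regular (LowerSet H.Condition)) : LowerSet H.Condition) := hp.1
    rw [Heyting.Regular.coe_iInf, LowerSet.mem_iInf_iff] at h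
    exact Provable.rel_congr p.smallIn_rhs h hp.2

variable (H) in
/-- The term that an element of the forcing model stands for. -/
def asTerm : H.model.Carrier → Term L := H.term

theorem term_termVal (e : Var.{u} → H.model.Carrier) (t : Term L) :
    H.asTerm (H.model.termVal e t) = t.subst fun x => H.asTerm (e x) := by
  cases t with
  | var x => rfl
  | const c => exact (H.exists_const c).choose_spec

/-- Instantiating the quantifier after substituting for the parameters amounts to one simultaneous
substitution, because variables standing for elements are not bound in the formula. -/
theorem subst_update {V : Set Var.{u}} {φ : Formula L}
    (hbv : ∀ d, Disjoint (H.asTerm d).fv (Formula.all V φ).bv) (e : Var.{u} → H.model.Carrier)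
    (a : V → H.model.Carrier) :
    (φ.subst (off V fun x => H.asTerm (e x))).subst
      (repl V fun x => H.asTerm (H.model.update e V a x)) =
      φ.subst fun x => H.asTerm (H.model.update e V a x) := by
  rw [Formula.subst_subst]
  · refine Formula.subst_congr fun x _ => ?_
    by_cases hx : x ∈ V
    · rw [off_of_mem hx]
      exact repl_of_mem (σ := fun x => H.asTerm (H.model.update e V a x)) hx
    · rw [off_of_notMem hx, BVModel.update_of_notMem _ hx]
      refine (Term.subst_congr _ fun y hy => ?_).trans (Term.subst_var _)
      exact repl_of_notMem fun hyV => Set.disjoint_left.1 (hbv (e x)) hy (Or.inl hyV)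
  · refine Formula.freeFor_of_disjoint_bv fun x _ => ?_
    by_cases hx : x ∈ V
    · exact Or.inl (off_of_mem hx)
    · rw [off_of_notMem hx]
      exact Or.inr ((hbv (e x)).mono_right Set.subset_union_right)

theorem exists_fresh (p : H.Condition) {V : Set Var.{u}} (hV : V.Finite) {φ : Formula L}
    (hφ : φ ∈ BasicInfOmega L) : ∃ w : Var.{u} → Var.{u}, Set.InjOn w V ∧
      (∀ x ∈ V, ∃ d, H.asTerm d = .var (w x)) ∧
      ∀ x ∈ V, ∀ ψ ∈ p.lhs ∪ p.rhs ∪ {φ}, w x ∉ ψ.fv := by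
  have hfin : (⋃ i ∈ p.pos ∪ p.neg, (H.formula i).fv).Finite :=
    (p.pos_finite.union p.neg_finite).biUnion fun i _ =>
      Formula.IsInfOmega.finite_fv (H.formula_mem i).1
  have hinf := H.infinite_fresh.sdiff (hfin.union (Formula.IsInfOmega.finite_fv hφ.1))
  obtain ⟨w, hw, hinj⟩ := hV.exists_injOn_of_encard_le (hinf.encard_eq ▸ le_top)
  refine ⟨w, hinj, fun x hx => (hw hx).1.1, fun x hx ψ hψ hm => ?_⟩
  have hx' := hw hx
  have hT : ψ ∉ T ∪ S := fun h => hx'.1.2 ψ h hm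
  rcases hψ with ((⟨i, hi, rfl⟩ | h) | (⟨i, hi, rfl⟩ | h)) | rfl
  · exact hx'.2 (Or.inl (Set.mem_biUnion (Or.inl hi) hm))
  · exact hT (Or.inl h)
  · exact hx'.2 (Or.inl (Set.mem_biUnion (Or.inr hi) hm))
  · exact hT (Or.inr h)
  · exact hx'.2 (Or.inr hm)

/-- From left to right by instantiation. Conversely, fresh variables are themselves elements, so one
instance suffices to apply the right rule for `∀`. -/
theorem forced_all {V : Set Var.{u}} {φ : Formula L} (ha : .all V φ ∈ BasicInfOmega L)
    (hbv : ∀ d, Disjoint (H.asTerm d).fv (Formula.all V φ).bv) (e : Var.{u} → H.model.Carrier)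
    (p : H.Condition) :
    Provable (BasicInfOmega L)
      (p.lhs, insert ((Formula.all V φ).subst fun x => H.asTerm (e x)) p.rhs) ↔
    ∀ a : V → H.model.Carrier, Provable (BasicInfOmega L)
      (p.lhs, insert (φ.subst fun x => H.asTerm (H.model.update e V a x)) p.rhs) := by
  have hφ : φ ∈ BasicInfOmega L := ⟨ha.1.2, ha.2⟩
  have hfree : ∀ a : V → H.model.Carrier, (φ.subst (off V fun x => H.asTerm (e x))).FreeFor
      (repl V fun x => H.asTerm (H.model.update e V a x)) := by
    refine fun a => Formula.freeFor_of_disjoint_bv fun x _ => ?_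
    by_cases hx : x ∈ V
    · rw [repl_of_mem hx, Formula.bv_subst]
      exact Or.inr ((hbv _).mono_right Set.subset_union_right)
    · exact Or.inl (repl_of_notMem hx)
  constructor
  · intro h a
    rw [← subst_update hbv]
    refine Provable.all_elim (hfree a) ?_ p.smallIn_rhs h
    exact subst_mem_basicInfOmega (subst_mem_basicInfOmega hφ _) _
  · intro h
    obtain ⟨w, hw, hd, hfresh⟩ := exists_fresh p ha.1.1
      (subst_mem_basicInfOmega hφ (off V fun x => H.asTerm (e x)))
    have := H.model.nonempty
    choose! d hd using hd
    have hr : repl V (fun x => H.asTerm (H.model.update e V (fun x => d x) x)) =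
        repl V fun x => .var (w x) := by
      funext x
      by_cases hx : x ∈ V
      · rw [repl_of_mem hx, repl_of_mem hx, BVModel.update_of_mem _ hx, hd x hx]
      · rw [repl_of_notMem hx, repl_of_notMem hx]
    have h' := h fun x => d x
    have hf := hfree fun x => d x
    rw [← subst_update hbv, hr] at h'
    rw [hr] at hf
    exact Provable.all_intro hw hfresh hf (subst_mem_basicInfOmega ha _) p.smallIn_rhs h'

/-- The truth lemma. Every instance of every subformula needs a code: negation extends conditions by
instances, and quantifiers change the assignment. -/
theorem coe_val {φ : Formula L} (hφ : φ ∈ BasicInfOmega L)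
    (hbv : ∀ d, Disjoint (H.asTerm d).fv φ.bv)
    (hsub : ∀ ψ ∈ φ.sub, ∀ e : Var.{u} → H.model.Carrier,
      (ψ.subst fun x => H.asTerm (e x)) ∈ Set.range H.formula) :
    ∀ (e : Var.{u} → H.model.Carrier), (H.model.val e φ : LowerSet H.Condition) =
      H.forced (φ.subst fun x => H.asTerm (e x)) (subst_mem_basicInfOmega hφ _) := by
  induction φ with
  | eq s t =>
    intro e
    ext p
    change Provable _ (p.lhs, insert (.eq (H.asTerm (H.model.termVal e s))
      (H.asTerm (H.model.termVal e t))) p.rhs) ↔ _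
    rw [term_termVal, term_termVal]
    rfl
  | rel R t =>
    intro e
    ext p
    change Provable _ (p.lhs, insert (.rel R fun i => H.asTerm (H.model.termVal e (t i))) p.rhs) ↔
      _
    simp only [term_termVal]
    rfl
  | neg φ ih =>
    intro e
    have hφ' : φ ∈ BasicInfOmega L := ⟨hφ.1, hφ.2⟩
    have ih := ih hφ' hbv (fun ψ hψ => hsub ψ (Or.inr hψ)) e
    change (↑(H.model.val e φ)ᶜ : LowerSet H.Condition) = _
    rw [Heyting.Regular.coe_compl, ih]
    ext p
    exact (mem_compl_forced (hsub φ (Or.inr φ.mem_sub) e)).trans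
      (Provable.neg_iff (subst_mem_basicInfOmega hφ' _) (subst_mem_basicInfOmega hφ _)
        p.smallIn_lhs p.smallIn_rhs).symm
  | conj ι φ ih =>
    intro e
    have hφ' : ∀ i, φ i ∈ BasicInfOmega L := fun i => ⟨hφ.1.2 i, hφ.2 i⟩
    have ih := fun i => ih i (hφ' i)
      (fun d => (hbv d).mono_right (Set.subset_iUnion (fun i => (φ i).bv) i))
      (fun ψ hψ => hsub ψ (Or.inr (Set.mem_iUnion.2 ⟨i, hψ⟩))) e
    change (↑(⨅ i, H.model.val e (φ i)) : LowerSet H.Condition) = _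
    rw [Heyting.Regular.coe_iInf]
    ext p
    simp only [ih, SetLike.mem_coe, LowerSet.mem_iInf_iff]
    exact (Provable.conj_iff (fun i => subst_mem_basicInfOmega (hφ' i) _)
      (subst_mem_basicInfOmega hφ _) p.smallIn_lhs p.smallIn_rhs).symm
  | disj ι φ ih => exact hφ.2.elim
  | ex V φ ih => exact hφ.2.elim
  | all V φ ih =>
    intro e
    have hφ' : φ ∈ BasicInfOmega L := ⟨hφ.1.2, hφ.2⟩
    have ih := ih hφ' (fun d => (hbv d).mono_right Set.subset_union_right)
      (fun ψ hψ => hsub ψ (Or.inr hψ))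
    change (↑(⨅ a : V → H.model.Carrier, H.model.val (H.model.update e V a) φ) :
      LowerSet H.Condition) = _
    rw [Heyting.Regular.coe_iInf]
    ext p
    simp only [ih, SetLike.mem_coe, LowerSet.mem_iInf_iff]
    exact (forced_all hφ hbv e p).symm

end Refutation

end BoolInf

namespace BoolInf

variable {L : Signature.{u}}

/-! ### Completeness -/

theorem Formula.small_sub (φ : Formula L) : Small.{u} φ.sub := by
  induction φ with
  | eq s t => exact small_single _
  | rel R t => exact small_single _
  | neg φ ih => exact small_insert _ _
  | conj ι φ ih | disj ι φ ih => exact small_insert _ _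
  | all V φ ih | ex V φ ih => exact small_insert _ _

theorem mem_basicInfOmega_of_mem_sub {φ ψ : Formula L} (hφ : φ ∈ BasicInfOmega L)
    (h : ψ ∈ φ.sub) : ψ ∈ BasicInfOmega L := by
  induction φ with
  | eq s t => exact h ▸ hφ
  | rel R t => exact h ▸ hφ
  | neg φ ih =>
    rcases h with rfl | h
    · exact hφ
    · exact ih ⟨hφ.1, hφ.2⟩ h
  | conj ι φ ih =>
    rcases h with rfl | h
    · exact hφ
    · obtain ⟨i, hi⟩ := Set.mem_iUnion.1 h
      exact ih i ⟨hφ.1.2 i, hφ.2 i⟩ hi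
  | disj ι φ ih => exact hφ.2.elim
  | all V φ ih =>
    rcases h with rfl | h
    · exact hφ
    · exact ih ⟨hφ.1.2, hφ.2⟩ h
  | ex V φ ih => exact hφ.2.elim

theorem small_bv {φ : Formula L} (hφ : φ.IsInfInf) : Small.{u} φ.bv := by
  induction φ with
  | eq s t => exact small_empty
  | rel R t => exact small_empty
  | neg φ ih => exact ih hφ
  | conj ι φ ih | disj ι φ ih =>
    have := fun i => ih i (hφ i)
    exact small_iUnion _
  | all V φ ih | ex V φ ih =>
    have := hφ.1
    have := ih hφ.2
    exact small_union _ _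

/-- An instance depends only on the values at the finitely many free variables, although there is a
proper class of assignments. -/
theorem small_subst {φ : Formula L} (hφ : φ ∈ BasicInfOmega L) {D : Type u} (t : D → Term L) :
    Small.{u} (Set.range fun e : Var.{u} → D => φ.subst fun x => t (e x)) := by
  classical
  have := (Formula.IsInfOmega.finite_fv hφ.1).to_subtype
  have : Small.{u} φ.fv := Countable.toSmall _
  refine small_subset (s := Set.range fun a : φ.fv → D => φ.subst fun x =>
    if h : x ∈ φ.fv then t (a ⟨x, h⟩) else .var x) ?_
  rintro _ ⟨e, rfl⟩
  exact ⟨fun x => e x, Formula.subst_congr fun x hx => dif_pos hx⟩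

theorem exists_bound {T : Set (Formula L)} (hT : SmallIn (BasicInfOmega L) T) :
    ∃ β : Ordinal.{u}, ∀ φ ∈ T, ∀ x ∈ φ.fv ∪ φ.bv, x < β := by
  have := hT.2
  have h : ∀ φ : T, Small.{u} (φ.1.fv ∪ φ.1.bv : Set Var.{u}) := by
    intro φ
    have hφ := hT.1 φ.2
    have := (Formula.IsInfOmega.finite_fv hφ.1).to_subtype
    have : Small.{u} φ.1.fv := Countable.toSmall _
    have := small_bv (Formula.IsInfOmega.isInfInf hφ.1)
    exact small_union _ _
  obtain ⟨β, hβ⟩ := Ordinal.bddAbove_of_small (s := ⋃ φ : T, (φ.1.fv ∪ φ.1.bv))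
  exact ⟨Order.succ β, fun φ hφ x hx =>
    Order.lt_succ_of_le (hβ (Set.mem_iUnion.2 ⟨⟨φ, hφ⟩, hx⟩))⟩

/-- The renaming of the variables `v_α` to `v_{β + α}`. -/
def shift (β : Ordinal.{u}) (x : Var.{u}) : Term L := .var (β + x)

/-- Bound variables stay below `β` and free ones move to `[β, β + β)`. The interval is a set, so the
substitution rule can undo the renaming. -/
theorem provable_of_shift {T S : Set (Formula L)} {β : Ordinal.{u}}
    (hT : SmallIn (BasicInfOmega L) T) (hS : SmallIn (BasicInfOmega L) S)
    (hβ : ∀ φ ∈ T ∪ S, ∀ x ∈ φ.fv ∪ φ.bv, x < β)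
    (h : Provable (BasicInfOmega L)
      (Formula.subst (shift β) '' T, Formula.subst (shift β) '' S)) :
    Provable (BasicInfOmega L) (T, S) := by
  let V : Set Var.{u} := Set.Ico β (β + β)
  let τ : Var.{u} → Term L := repl V fun x => .var (x - β)
  have hτ : ∀ x < β, τ (β + x) = .var x := by
    intro x hx
    have hV : β + x ∈ V := ⟨le_self_add, (add_lt_add_iff_left β).2 hx⟩
    refine (repl_of_mem hV).trans ?_
    rw [Ordinal.add_sub_cancel]
  have hinv : ∀ φ ∈ T ∪ S, (φ.subst (shift β)).subst τ = φ := by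
    intro φ hφ
    rw [Formula.subst_subst]
    · refine (Formula.subst_congr fun x hx => ?_).trans φ.subst_var
      exact hτ x (hβ φ hφ x (Or.inl hx))
    · refine Formula.freeFor_of_disjoint_bv fun x _ => Or.inr ?_
      refine Set.disjoint_singleton_left.2 fun hx => ?_
      exact (hβ φ hφ _ (Or.inr hx)).not_ge le_self_add
  have himg : ∀ A ⊆ T ∪ S, Formula.subst τ '' (Formula.subst (shift β) '' A) = A := by
    intro A hA
    rw [Set.image_image]
    exact (Set.image_congr fun φ hφ => hinv φ (hA hφ)).trans (Set.image_id A)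
  have hr := Rule.substitution (Formula.subst (shift β) '' T) (Formula.subst (shift β) '' S) V
    (fun x => x - β) inferInstance (by
      rw [← Set.image_union]
      rintro _ ⟨φ, hφ, rfl⟩
      refine Formula.freeFor_subst_of_leftInverse fun x hx =>
        ⟨β + x, fun hm => ?_, rfl, hτ x (hβ φ hφ x (Or.inl hx))⟩
      exact (hβ φ hφ _ (Or.inr hm)).not_ge le_self_add)
  rw [himg T Set.subset_union_left, himg S Set.subset_union_right] at hr
  refine .step _ _ hr ⟨hT, hS⟩ ?_
  rintro p rfl
  exact h

theorem SmallIn.subst {T : Set (Formula L)} (hT : SmallIn (BasicInfOmega L) T)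
    (σ : Var.{u} → Term L) : SmallIn (BasicInfOmega L) (Formula.subst σ '' T) := by
  have := hT.2
  exact ⟨Set.image_subset_iff.2 fun φ hφ => subst_mem_basicInfOmega (hT.1 hφ) σ, inferInstance⟩

theorem exists_refutation {T S : Set (Formula L)} (hT : SmallIn (BasicInfOmega L) T)
    (hS : SmallIn (BasicInfOmega L) S) (h : ¬ Provable (BasicInfOmega L) (T, S)) :
    ∃ (σ : Var.{u} → Term L) (H : Refutation (Formula.subst σ '' T) (Formula.subst σ '' S))
      (e : Var.{u} → H.Elem), ∀ φ ∈ T ∪ S,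
        (∀ d, Disjoint (H.term d).fv φ.bv) ∧
        (∀ ψ ∈ φ.sub, ∀ e : Var.{u} → H.Elem,
          (ψ.subst fun x => H.term (e x)) ∈ Set.range H.formula) ∧
        (φ.subst fun x => H.term (e x)) = φ.subst σ := by
  classical
  obtain ⟨β, hβ⟩ := exists_bound (hT.union hS)
  -- The block `[β, β + β)` holds the renamed free variables, the last `ω` variables are fresh, and
  -- all bound variables lie below `β`.
  let C : Set Var.{u} := Set.Ico β (β + β + Ordinal.omega0)
  let D : Type u := Shrink.{u} C ⊕ L.Const
  let t : D → Term L := Sum.elim (fun y => .var ((equivShrink C).symm y)) .const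
  have hC : ∀ y (hy : y ∈ C), t (Sum.inl (equivShrink C ⟨y, hy⟩)) = .var y := by
    intro y hy
    simp only [t, Sum.elim_inl, Equiv.symm_apply_apply]
  have hT' := hT.2
  have hS' := hS.2
  -- The formulae to be coded: instances of subformulae for the truth lemma, and atoms for the
  -- model. They form a set, which keeps the algebra in `Type u`.
  let G : Set (Formula L) := (⋃ χ : ⋃ φ : (T ∪ S : Set (Formula L)), φ.1.sub,
      Set.range fun e : Var.{u} → D => χ.1.subst fun x => t (e x)) ∪
    (Set.range fun d : D × D => .eq (t d.1) (t d.2)) ∪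
    Set.range fun a : Σ R : L.Rel, Fin (L.arity R) → D => .rel a.1 fun i => t (a.2 i)
  have hsub : ∀ χ : ⋃ φ : (T ∪ S : Set (Formula L)), φ.1.sub, χ.1 ∈ BasicInfOmega L := by
    rintro ⟨χ, hχ⟩
    obtain ⟨φ, hφ⟩ := Set.mem_iUnion.1 hχ
    exact mem_basicInfOmega_of_mem_sub ((hT.union hS).1 φ.2) hφ
  have hG : Small.{u} G := by
    have := fun φ : (T ∪ S : Set (Formula L)) => φ.1.small_sub
    have := fun χ => small_subst (hsub χ) t
    exact inferInstance
  have hGF : G ⊆ BasicInfOmega L := by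
    rintro ψ ((hψ | ⟨d, rfl⟩) | ⟨a, rfl⟩)
    · obtain ⟨χ, e, rfl⟩ := Set.mem_iUnion.1 hψ
      exact subst_mem_basicInfOmega (hsub χ) _
    · exact ⟨trivial, trivial⟩
    · exact ⟨trivial, trivial⟩
  have hrange : Set.range (fun i : Shrink.{u} G => ((equivShrink G).symm i : Formula L)) = G :=
    ((equivShrink G).symm.surjective.range_comp _).trans Subtype.range_coe
  have hfresh : ∀ n : ℕ, β + β + (n : Ordinal.{u}) ∈
      {y | (∃ d, t d = .var y) ∧ ∀ ψ ∈ Formula.subst (shift β) '' T ∪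
        Formula.subst (shift β) '' S, y ∉ ψ.fv} := by
    refine fun n => ⟨⟨_, hC _ ⟨?_, ?_⟩⟩, ?_⟩
    · exact le_self_add.trans le_self_add
    · gcongr
      exact Ordinal.natCast_lt_omega0 n
    · rw [← Set.image_union]
      rintro _ ⟨φ, hφ, rfl⟩ hy
      obtain ⟨x, hx, hxy⟩ := Formula.mem_fv_subst hy
      have hxβ := hβ φ hφ x (Or.inl hx)
      have hxy : β + β + (n : Ordinal.{u}) = β + x := hxy
      rw [add_assoc, add_right_inj] at hxy
      exact hxβ.not_ge (hxy ▸ le_self_add)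
  let H : Refutation (Formula.subst (shift β) '' T) (Formula.subst (shift β) '' S) :=
    { left := hT.subst _
      right := hS.subst _
      not_provable := fun hp => h (provable_of_shift hT hS hβ hp)
      Code := Shrink.{u} G
      formula := fun i => (equivShrink G).symm i
      formula_mem := fun i => hGF ((equivShrink G).symm i).2
      Elem := D
      term := t
      exists_const := fun c => ⟨Sum.inr c, rfl⟩
      eq_mem := fun d d' => hrange.symm ▸ Or.inl (Or.inr ⟨(d, d'), rfl⟩)
      rel_mem := fun R a => hrange.symm ▸ Or.inr ⟨⟨R, a⟩, rfl⟩
      infinite_fresh := Set.infinite_of_injective_forall_mem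
        (fun _ _ h => Nat.cast_injective (add_left_cancel h)) hfresh }
  have hshift : ∀ x < β, β + x ∈ C := fun x hx =>
    ⟨le_self_add, ((add_lt_add_iff_left β).2 hx).trans_le le_self_add⟩
  obtain ⟨-, d₀, -⟩ := H.exists_var
  -- The default `d₀` is harmless, since free variables of `T ∪ S` lie below `β`.
  refine ⟨shift β, H, fun x => if hx : x < β then
    Sum.inl (equivShrink C ⟨β + x, hshift x hx⟩) else d₀, fun φ hφ => ⟨?_, ?_, ?_⟩⟩
  · rintro (y | c)
    · refine Set.disjoint_singleton_left.2 fun hy => ?_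
      exact (hβ φ hφ _ (Or.inr hy)).not_ge ((equivShrink C).symm y).2.1
    · exact Set.empty_disjoint _
  · intro ψ hψ e
    exact hrange.symm ▸ Or.inl (Or.inl (Set.mem_iUnion.2
      ⟨⟨ψ, Set.mem_iUnion.2 ⟨⟨φ, hφ⟩, hψ⟩⟩, e, rfl⟩))
  · refine Formula.subst_congr fun x hx => ?_
    have hxβ := hβ φ hφ x (Or.inl hx)
    simp only [dif_pos hxβ]
    exact hC _ (hshift x hxβ)

theorem Refutation.forced_eq_top {T S : Set (Formula L)} (H : Refutation T S) {φ : Formula L}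
    (hφ : φ ∈ T) (hF : φ ∈ BasicInfOmega L) : H.forced φ hF = ⊤ :=
  top_le_iff.1 fun p _ => Provable.of_mem p.smallIn_lhs (p.smallIn_rhs.insert hF) (Or.inr hφ)
    (Set.mem_insert _ _)

/-- Adding `φ` to a right side that already contains it changes nothing, and conditions are
unprovable. -/
theorem Refutation.forced_eq_bot {T S : Set (Formula L)} (H : Refutation T S) {φ : Formula L}
    (hφ : φ ∈ S) (hF : φ ∈ BasicInfOmega L) : H.forced φ hF = ⊥ := by
  refine le_bot_iff.1 fun p hp => p.not_provable ?_
  have hp : Provable _ (p.lhs, insert φ p.rhs) := hp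
  have hm : φ ∈ p.rhs := Or.inr hφ
  rwa [Set.insert_eq_of_mem hm] at hp

theorem provable_of_entailsSh {T S : Set (Formula L)} (hT : SmallIn (BasicInfOmega L) T)
    (hS : SmallIn (BasicInfOmega L) S) (h : EntailsSh T S) :
    Provable (BasicInfOmega L) (T, S) := by
  by_contra hn
  obtain ⟨σ, H, e, he⟩ := exists_refutation hT hS hn
  let e : Var.{u} → H.model.Carrier := e
  have hv : ∀ φ (hφ : φ ∈ T ∪ S), (H.model.val e φ : LowerSet H.Condition) =
      H.forced (φ.subst σ) (subst_mem_basicInfOmega ((hT.union hS).1 hφ) σ) := by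
    intro φ hφ
    obtain ⟨h₁, h₂, h₃⟩ := he φ hφ
    rw [Refutation.coe_val ((hT.union hS).1 hφ) h₁ h₂]
    congr 1
  have hle := h _ H.model.completion H.model.completion_mixing
    fun x => H.model.toCompletion (e x)
  have htop : (⊤ : Heyting.Regular (LowerSet H.Condition)) ≤
      ⨅ φ ∈ T, H.model.completion.val (fun x => H.model.toCompletion (e x)) φ := by
    refine le_iInf₂ fun φ hφ => ?_
    rw [H.model.completion_val (hT.1 hφ), ← Heyting.Regular.coe_le_coe, hv φ (Or.inl hφ),
      H.forced_eq_top ⟨φ, hφ, rfl⟩]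
    exact le_top
  have hbot : (⨆ φ ∈ S, H.model.completion.val (fun x => H.model.toCompletion (e x)) φ) ≤
      (⊥ : Heyting.Regular (LowerSet H.Condition)) := by
    refine iSup₂_le fun φ hφ => ?_
    rw [H.model.completion_val (hS.1 hφ), ← Heyting.Regular.coe_le_coe, hv φ (Or.inr hφ),
      H.forced_eq_bot ⟨φ, hφ, rfl⟩]
    exact bot_le
  have hF := (htop.trans hle).trans hbot
  -- The unextended sequent is a condition, so the algebra is nontrivial.
  let p : H.Condition := ⟨∅, ∅, Set.finite_empty, Set.finite_empty, by
    rw [Set.image_empty, Set.empty_union, Set.empty_union]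
    exact H.not_provable⟩
  have hp : p ∈ (⊥ : LowerSet H.Condition) := hF (LowerSet.mem_top (a := p))
  exact LowerSet.notMem_bot hp

theorem smallIn_basic {T : Set (Formula L)} (hT : T ⊆ LInfOmega L) (hs : Small.{u} T) :
    SmallIn (BasicInfOmega L) (Formula.basic '' T) :=
  ⟨Set.image_subset_iff.2 fun φ hφ => ⟨Formula.IsInfOmega.basic (hT hφ), φ.isBasic_basic⟩,
    inferInstance⟩

end BoolInf

/-! ### The equivalence -/

theorem mainTheorem1 (L : BoolInf.Signature.{u}) (T S : Set (BoolInf.Formula.{u} L))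
    (hT : T ⊆ BoolInf.LInfOmega L) (hS : S ⊆ BoolInf.LInfOmega L)
    (hTsmall : Small.{u} T) (hSsmall : Small.{u} S) :
    List.TFAE
      [BoolInf.EntailsSh T S,
       BoolInf.EntailsBVM T S,
       BoolInf.Proves (BoolInf.LInfInf L) T S,
       BoolInf.Proves (BoolInf.LInfOmega L) T S] := by
  tfae_have 2 → 1 := fun h B _ M _ => h B M
  tfae_have 3 → 2 := BoolInf.Proves.entailsBVM
  tfae_have 4 → 3 := fun h => BoolInf.Provable.mono
    (Set.inter_subset_inter_left _ fun _ hφ => BoolInf.Formula.IsInfOmega.isInfInf hφ) h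
  tfae_have 1 → 4 := fun h => BoolInf.provable_of_entailsSh (BoolInf.smallIn_basic hT hTsmall)
    (BoolInf.smallIn_basic hS hSsmall) fun B _ M hM => M.satisfies_basic.2 (h B M hM)
  tfae_finish
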